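/- **Setting.** Let $\Pi$ be a two-dimensional real vector space with an area form $\Omega$ (a nonzero skew-symmetric bilinear form). Let $V$ be the three-dimensional space of traceless endomorphisms of $\Pi$, with the Lorentzian $(-++)$ inner product characterized by $\langle A,A\rangle=-\det A$, and let $\mathrm{SO}^\uparrow(V)$ be the identity component of the Lorentz group of $(V,\langle\cdot,\cdot\rangle)$. The *future null cone* is $\Sigma=\{\Phi(y):y\in\Pi\smallsetminus\{0\}\}\subset V$, where $\Phi(y)=\Omega(y,\cdot)\otimes y$, that is, $\Phi(y)z=\Omega(y,z)\,y$. For $a,b\in\mathbb R$ with $ab=0$, let $\nabla(a,b)$ be the left-invariant torsion-free connection on the two-dimensional non-Abelian simply connected Lie group given, in a basis $u,w$ of left-invariant vector fields with $[u,w]=2u$, by $$\nabla_u u=(3+a)u-aw,\quad \nabla_u w=au+(3-a)w,\quad \nabla_w u=(a-2)u+(3-a)w,\quad \nabla_w w=(a+b-1)u+(2-a)w .$$ A connection $\nabla$ on a surface is said to *represent the point $(a,b)$ of the moduli curve $\{ab=0\}$* if it is locally equivalent to $\nabla(a,b)$: for any point $p$ of the surface and any point $q$ of the group, some neighbourhood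 of $p$ admits an affine diffeomorphism onto a neighbourhood of $q$ sending $p$ to $q$. **Proposition.** The group $\mathrm{SO}^\uparrow(V)$ maps $\Sigma$ into itself and acts on it transitively, and $\Sigma$ is an embedded $C^\infty$ surface in $V$. On $\Sigma$ there is a one-parameter family $\nabla^c$, $c\in\mathbb R\smallsetminus\{0\}$, of $C^\infty$ torsion-free connections, depending smoothly on $c$ and such that $\nabla^c\ne\nabla^{c'}$ whenever $c\ne c'$, with the following properties for every $c\neq0$: $\nabla^c$ is invariant under the action of $\mathrm{SO}^\uparrow(V)$ on $\Sigma$; its Ricci tensor is skew-symmetric and nonzero at every point; and $\nabla^c$ represents the point $(a,b)=(1,0)$ of the moduli curve. -/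

import Mathlib

open scoped Manifold ContDiff Topology

noncomputable section

/-! ## Curvature, Ricci tensor and affine maps for connections on manifolds

A connection on `M` is a `CovariantDerivative` on the tangent bundle; `cov Y x (X x)` is the value
at `x` of the covariant derivative of `Y` in the direction of `X`. -/

section Connections

variable {E : Type*} [NormedAddCommGroup E] [NormedSpace ℝ E]
  {H : Type*} [TopologicalSpace H] {I : ModelWithCorners ℝ E H}
  {M : Type*} [TopologicalSpace M] [ChartedSpace H M]
  {E' : Type*} [NormedAddCommGroup E'] [NormedSpace ℝ E']
  {H' : Type*} [TopologicalSpace H'] {I' : ModelWithCorners ℝ E' H'}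
  {M' : Type*} [TopologicalSpace M'] [ChartedSpace H' M']

/-- The vector field `X` is `C^∞` at the point `x`. -/
def SmoothFieldAt [IsManifold I 1 M] (X : Π z : M, TangentSpace I z) (x : M) : Prop :=
  ContMDiffAt I I.tangent ∞ (fun z ↦ (⟨z, X z⟩ : TangentBundle I M)) x

/-- The curvature operator
`R(X, Y) Z = ∇_Y ∇_X Z - ∇_X ∇_Y Z + ∇_[X, Y] Z` (this is the sign convention in use). -/
def curvatureField [IsManifold I 1 M]
    (cov : CovariantDerivative I E (TangentSpace I : M → Type _))
    (X Y Z : Π x : M, TangentSpace I x) (x : M) : TangentSpace I x :=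
  cov (fun z ↦ cov Z z (X z)) x (Y x) - cov (fun z ↦ cov Z z (Y z)) x (X x)
    + cov Z x (VectorField.mlieBracket I X Y x)

/-- The Ricci tensor `ρ(v, z)` at `x`: the trace of `y ↦ R(v, y) z` on the tangent space at `x`,
computed in a basis. Tangent vectors at `x` are extended to vector fields which are smooth near `x`;
for a smooth connection the result depends neither on the extensions nor on the basis. -/
def ricci [FiniteDimensional ℝ E] [IsManifold I 1 M]
    (cov : CovariantDerivative I E (TangentSpace I : M → Type _))
    (x : M) (v z : TangentSpace I x) : ℝ :=
  ∑ i, (Module.finBasis ℝ E).coord i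
    (curvatureField cov (FiberBundle.extend E v)
      (FiberBundle.extend E (show TangentSpace I x from Module.finBasis ℝ E i))
      (FiberBundle.extend E z) x)

/-- A smooth torsion-free connection whose Ricci tensor is skew-symmetric and
nonzero at every point. -/
structure IsNonzeroRSTS [FiniteDimensional ℝ E] [IsManifold I ∞ M]
    (cov : CovariantDerivative I E (TangentSpace I : M → Type _)) : Prop where
  smooth : CovariantDerivative.ContMDiffCovariantDerivative cov ∞
  torsionFree : cov.torsion = 0
  ricci_skew : ∀ (x : M) (v z : TangentSpace I x), ricci cov x v z = - ricci cov x z v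
  ricci_ne_zero : ∀ x : M, ∃ v z : TangentSpace I x, ricci cov x v z ≠ 0

/-- The differential of `f` at `x` intertwines the two connections: whenever the smooth vector
fields `X`, `Y` are `f`-related near `x`, one has `df (∇_v X) = ∇'_{df v} Y` for all `v ∈ T_x M`. -/
def IntertwinesAt [IsManifold I 1 M] [IsManifold I' 1 M']
    (cov : CovariantDerivative I E (TangentSpace I : M → Type _))
    (cov' : CovariantDerivative I' E' (TangentSpace I' : M' → Type _))
    (f : M → M') (x : M) : Prop :=
  ∀ (X : Π z : M, TangentSpace I z) (Y : Π z : M', TangentSpace I' z),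
    SmoothFieldAt X x → SmoothFieldAt Y (f x) →
    (∀ᶠ z in 𝓝 x, mfderiv I I' f z (X z) = Y (f z)) →
    ∀ v : TangentSpace I x, mfderiv I I' f x (cov X x v) = cov' Y (f x) (mfderiv I I' f x v)

/-- `f` restricts to an affine diffeomorphism from a neighbourhood of `x` onto a
neighbourhood of `f x`. -/
def IsAffineDiffeoAt [IsManifold I 1 M] [IsManifold I' 1 M']
    (cov : CovariantDerivative I E (TangentSpace I : M → Type _))
    (cov' : CovariantDerivative I' E' (TangentSpace I' : M' → Type _))
    (f : M → M') (x : M) : Prop :=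
  IsLocalDiffeomorphAt I I' ∞ f x ∧ ∀ᶠ z in 𝓝 x, IntertwinesAt cov cov' f z

/-- Local equivalence of (locally homogeneous) connections: any two points of the two manifolds have
neighbourhoods related by an affine diffeomorphism that sends one point to the other. -/
def LocallyEquivalent [IsManifold I 1 M] [IsManifold I' 1 M']
    (cov : CovariantDerivative I E (TangentSpace I : M → Type _))
    (cov' : CovariantDerivative I' E' (TangentSpace I' : M' → Type _)) : Prop :=
  ∀ (p : M) (q : M'), ∃ f : M → M', f p = q ∧ IsAffineDiffeoAt cov cov' f p

end Connections

/-! ## The model connections `∇(a, b)`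

The simply connected non-Abelian Lie group of dimension two is `ℝ × ℝ` with the product
`(s, t) (s', t') = (s + exp (-2 t) s', t + t')`; `modelU` and `modelW` are the left-invariant vector
fields `u = exp (-2 t) ∂_s` and `w = ∂_t`, which satisfy `[u, w] = 2 u`. -/

/-- The product of the two-dimensional non-Abelian simply connected Lie group. -/
def modelMul (p q : ℝ × ℝ) : ℝ × ℝ := (p.1 + Real.exp (-2 * p.2) * q.1, p.2 + q.2)

/-- The left-invariant vector field `u`. -/
def modelU (p : ℝ × ℝ) : ℝ × ℝ := (Real.exp (-2 * p.2), 0)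

/-- The left-invariant vector field `w`. -/
def modelW (_ : ℝ × ℝ) : ℝ × ℝ := (0, 1)

/-- Left invariance of `u` and `w`. -/
theorem model_leftInvariant (p q : ℝ × ℝ) :
    fderiv ℝ (modelMul p) q (modelU q) = modelU (modelMul p q) ∧
    fderiv ℝ (modelMul p) q (modelW q) = modelW (modelMul p q) := by
  have h : HasFDerivAt (modelMul p)
      ((Real.exp (-2 * p.2) • ContinuousLinearMap.fst ℝ ℝ ℝ).prod
        (ContinuousLinearMap.snd ℝ ℝ ℝ)) q := by
    refine HasFDerivAt.prodMk ?_ ?_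
    · exact (((ContinuousLinearMap.fst ℝ ℝ ℝ).hasFDerivAt (x := q)).const_mul
        (Real.exp (-2 * p.2))).const_add p.1
    · exact ((ContinuousLinearMap.snd ℝ ℝ ℝ).hasFDerivAt (x := q)).const_add p.2
  rw [h.fderiv]
  constructor
  · change ((Real.exp (-2 * p.2) * Real.exp (-2 * q.2), (0 : ℝ)) : ℝ × ℝ)
      = (Real.exp (-2 * (p.2 + q.2)), 0)
    rw [← Real.exp_add]
    congr 2
    ring
  · change ((Real.exp (-2 * p.2) * 0, (1 : ℝ)) : ℝ × ℝ) = (0, 1)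
    simp

/-- The `u`-component of a vector field (with respect to the frame `u`, `w`). -/
def modelCoeffU (X : ℝ × ℝ → ℝ × ℝ) (p : ℝ × ℝ) : ℝ :=
  Real.exp (2 * p.2) * (X p).1

/-- The `w`-component of a vector field (with respect to the frame `u`, `w`). -/
def modelCoeffW (X : ℝ × ℝ → ℝ × ℝ) (p : ℝ × ℝ) : ℝ :=
  (X p).2

/-- The linear map `T_p → T_p` sending `u` to `A` and `w` to `B`. -/
def modelMap (p A B : ℝ × ℝ) : (ℝ × ℝ) →L[ℝ] (ℝ × ℝ) :=
  (Real.exp (2 * p.2) • ContinuousLinearMap.fst ℝ ℝ ℝ).smulRight A +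
    (ContinuousLinearMap.snd ℝ ℝ ℝ).smulRight B

/-- The bundle morphism `v ↦ ∇_v u` of `∇(a, b)`:
`∇_u u = (3 + a) u - a w` and `∇_w u = (a - 2) u + (3 - a) w`. -/
def modelNablaU (a : ℝ) (p : ℝ × ℝ) : (ℝ × ℝ) →L[ℝ] (ℝ × ℝ) :=
  modelMap p ((3 + a) • modelU p - a • modelW p) ((a - 2) • modelU p + (3 - a) • modelW p)

/-- The bundle morphism `v ↦ ∇_v w` of `∇(a, b)`:
`∇_u w = a u + (3 - a) w` and `∇_w w = (a + b - 1) u + (2 - a) w`. -/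
def modelNablaW (a b : ℝ) (p : ℝ × ℝ) : (ℝ × ℝ) →L[ℝ] (ℝ × ℝ) :=
  modelMap p (a • modelU p + (3 - a) • modelW p) ((a + b - 1) • modelU p + (2 - a) • modelW p)

/-- The morphism `v ↦ α(v) u + β(v) w + f ∇_v u + g ∇_v w`. -/
def modelValue (a b : ℝ) (α β : (ℝ × ℝ) →L[ℝ] ℝ) (f g : ℝ) (p : ℝ × ℝ) :
    (ℝ × ℝ) →L[ℝ] (ℝ × ℝ) :=
  α.smulRight (modelU p) + β.smulRight (modelW p) +
    f • modelNablaU a p + g • modelNablaW a b p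

theorem modelValue_apply (a b : ℝ) (α β : (ℝ × ℝ) →L[ℝ] ℝ) (f g : ℝ) (p v : ℝ × ℝ) :
    modelValue a b α β f g p v =
      α v • modelU p + β v • modelW p + f • modelNablaU a p v + g • modelNablaW a b p v := rfl

theorem model_differentiableAt {X : Π p : ℝ × ℝ, TangentSpace 𝓘(ℝ, ℝ × ℝ) p} {p : ℝ × ℝ}
    (hX : MDifferentiableAt 𝓘(ℝ, ℝ × ℝ) 𝓘(ℝ, ℝ × ℝ).tangent
      (fun z ↦ (⟨z, X z⟩ : TangentBundle 𝓘(ℝ, ℝ × ℝ) (ℝ × ℝ))) p) :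
    DifferentiableAt ℝ (modelCoeffU X) p ∧ DifferentiableAt ℝ (modelCoeffW X) p := by
  have h : DifferentiableAt ℝ (fun z ↦ (X z : ℝ × ℝ)) p := by
    have h' := (mdifferentiableAt_section 𝓘(ℝ, ℝ × ℝ) X).1 hX
    simp at h'
    exact h'.differentiableAt
  have he : DifferentiableAt ℝ (fun z : ℝ × ℝ ↦ Real.exp (2 * z.2)) p := by fun_prop
  exact ⟨he.mul h.fst, h.snd⟩

/-- The left-invariant connection `∇(a, b)`, written out by the Leibniz rule in the frame `u`, `w`:
for `X = f u + g w`, one has `∇_v X = (d_v f) u + (d_v g) w + f ∇_v u + g ∇_v w`. -/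
def modelConnection (a b : ℝ) :
    CovariantDerivative 𝓘(ℝ, ℝ × ℝ) (ℝ × ℝ) (TangentSpace 𝓘(ℝ, ℝ × ℝ) : ℝ × ℝ → Type _) where
  toFun X p :=
    modelValue a b (fderiv ℝ (modelCoeffU X) p) (fderiv ℝ (modelCoeffW X) p)
      (modelCoeffU X p) (modelCoeffW X p) p
  isCovariantDerivativeOnUniv :=
    { add := by
        intro X Y p hX hY _
        obtain ⟨hX1, hX2⟩ := model_differentiableAt hX
        obtain ⟨hY1, hY2⟩ := model_differentiableAt hY
        have h1 : modelCoeffU (X + Y) = modelCoeffU X + modelCoeffU Y := by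
          funext z; exact mul_add _ _ _
        have h2 : modelCoeffW (X + Y) = modelCoeffW X + modelCoeffW Y := rfl
        refine ContinuousLinearMap.ext fun v ↦ ?_
        have e1 : fderiv ℝ (modelCoeffU (X + Y)) p =
            fderiv ℝ (modelCoeffU X) p + fderiv ℝ (modelCoeffU Y) p := by
          rw [h1]; exact fderiv_add hX1 hY1
        have e2 : fderiv ℝ (modelCoeffW (X + Y)) p =
            fderiv ℝ (modelCoeffW X) p + fderiv ℝ (modelCoeffW Y) p := by
          rw [h2]; exact fderiv_add hX2 hY2
        change modelValue a b (fderiv ℝ (modelCoeffU (X + Y)) p)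
            (fderiv ℝ (modelCoeffW (X + Y)) p) (modelCoeffU (X + Y) p)
            (modelCoeffW (X + Y) p) p v =
          modelValue a b (fderiv ℝ (modelCoeffU X) p) (fderiv ℝ (modelCoeffW X) p)
            (modelCoeffU X p) (modelCoeffW X p) p v +
          modelValue a b (fderiv ℝ (modelCoeffU Y) p) (fderiv ℝ (modelCoeffW Y) p)
            (modelCoeffU Y p) (modelCoeffW Y p) p v
        rw [e1, e2, h1, h2]
        simp only [modelValue_apply, add_apply, Pi.add_apply]
        module
      leibniz := by
        intro X g p hX hg _
        obtain ⟨hX1, hX2⟩ := model_differentiableAt hX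
        have hg' : DifferentiableAt ℝ g p := hg.differentiableAt
        have h1 : modelCoeffU (g • X) = g * modelCoeffU X := by
          funext z; exact mul_left_comm _ _ _
        have h2 : modelCoeffW (g • X) = g * modelCoeffW X := rfl
        refine ContinuousLinearMap.ext fun v ↦ ?_
        have e1 : fderiv ℝ (modelCoeffU (g • X)) p =
            g p • fderiv ℝ (modelCoeffU X) p + modelCoeffU X p • fderiv ℝ g p := by
          rw [h1]; exact fderiv_mul hg' hX1
        have e2 : fderiv ℝ (modelCoeffW (g • X)) p =
            g p • fderiv ℝ (modelCoeffW X) p + modelCoeffW X p • fderiv ℝ g p := by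
          rw [h2]; exact fderiv_mul hg' hX2
        have e3 : (((X p).1, (X p).2) : ℝ × ℝ) =
            modelCoeffU X p • modelU p + modelCoeffW X p • modelW p := by
          have h0 : Real.exp (2 * p.2) * Real.exp (-2 * p.2) = 1 := by
            rw [← Real.exp_add]; simp
          refine Prod.ext ?_ ?_
          · change (X p).1 = Real.exp (2 * p.2) *
              (X p).1 * Real.exp (-2 * p.2) +
              modelCoeffW X p * 0
            linear_combination (-(X p).1) * h0
          · change (X p).2 = modelCoeffU X p * 0 +
              (X p).2 * 1
            ring
        have e4 : ∀ t : ℝ, t • (((X p).1, (X p).2) : ℝ × ℝ) =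
            t • (modelCoeffU X p • modelU p + modelCoeffW X p • modelW p) :=
          fun t ↦ congrArg (t • ·) e3
        have e5 : mvfderiv 𝓘(ℝ, ℝ × ℝ) g p = fderiv ℝ g p := by
          simp [mvfderiv, mfderiv_eq_fderiv]
          rfl
        change modelValue a b (fderiv ℝ (modelCoeffU (g • X)) p)
            (fderiv ℝ (modelCoeffW (g • X)) p) (modelCoeffU (g • X) p)
            (modelCoeffW (g • X) p) p v =
          g p • modelValue a b (fderiv ℝ (modelCoeffU X) p) (fderiv ℝ (modelCoeffW X) p)
            (modelCoeffU X p) (modelCoeffW X p) p v +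
          (mvfderiv 𝓘(ℝ, ℝ × ℝ) g p v) • (((X p).1, (X p).2) : ℝ × ℝ)
        rw [e4, e5, e1, e2, h1, h2]
        simp only [modelValue_apply, add_apply, smul_apply, Pi.mul_apply, smul_eq_mul]
        module }

/-- The four equations that define `∇(a, b)`. -/
theorem modelConnection_frame (a b : ℝ) (p : ℝ × ℝ) :
    modelConnection a b modelU p (modelU p) = (3 + a) • modelU p - a • modelW p ∧
    modelConnection a b modelW p (modelU p) = a • modelU p + (3 - a) • modelW p ∧
    modelConnection a b modelU p (modelW p) = (a - 2) • modelU p + (3 - a) • modelW p ∧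
    modelConnection a b modelW p (modelW p) =
      (a + b - 1) • modelU p + (2 - a) • modelW p := by
  have hu1 : modelCoeffU modelU = fun _ ↦ 1 := by
    funext z
    change Real.exp (2 * z.2) * Real.exp (-2 * z.2) = 1
    rw [← Real.exp_add]; simp
  have hu2 : modelCoeffW modelU = fun _ ↦ 0 := rfl
  have hw1 : modelCoeffU modelW = fun _ ↦ 0 := by
    funext z
    exact mul_zero _
  have hw2 : modelCoeffW modelW = fun _ ↦ 1 := rfl
  have hm : ∀ A B : ℝ × ℝ, modelMap p A B (modelU p) = A ∧ modelMap p A B (modelW p) = B := by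
    intro A B
    have h0 : Real.exp (2 * p.2) * Real.exp (-2 * p.2) = 1 := by
      rw [← Real.exp_add]; simp
    constructor
    · change (Real.exp (2 * p.2) * Real.exp (-2 * p.2)) • A + (0 : ℝ) • B = A
      rw [h0]; simp
    · change (Real.exp (2 * p.2) * 0) • A + (1 : ℝ) • B = B
      simp
  have key : ∀ (X : ℝ × ℝ → ℝ × ℝ) (v : ℝ × ℝ), modelConnection a b X p v =
      modelValue a b (fderiv ℝ (modelCoeffU X) p) (fderiv ℝ (modelCoeffW X) p)
        (modelCoeffU X p) (modelCoeffW X p) p v := fun _ _ ↦ rfl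
  refine ⟨?_, ?_, ?_, ?_⟩ <;>
    rw [key] <;>
    simp [modelValue_apply, hu1, hu2, hw1, hw2, modelNablaU, modelNablaW, hm] <;>
    rfl

/-- The bracket relation `[u, w] = 2 u`. -/
theorem model_bracket (p : ℝ × ℝ) :
    VectorField.lieBracket ℝ modelU modelW p = (2 : ℝ) • modelU p := by
  have h2 : HasFDerivAt (fun z : ℝ × ℝ ↦ Real.exp (-2 * z.2))
      (Real.exp (-2 * p.2) • ((-2 : ℝ) • ContinuousLinearMap.snd ℝ ℝ ℝ)) p :=
    ((ContinuousLinearMap.snd ℝ ℝ ℝ).hasFDerivAt.const_mul (-2 : ℝ)).exp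
  have h : HasFDerivAt modelU ((Real.exp (-2 * p.2) •
      ((-2 : ℝ) • ContinuousLinearMap.snd ℝ ℝ ℝ)).prod 0) p :=
    h2.prodMk (hasFDerivAt_const (0 : ℝ) p)
  have h' : HasFDerivAt modelW (0 : (ℝ × ℝ) →L[ℝ] (ℝ × ℝ)) p := hasFDerivAt_const _ p
  rw [VectorField.lieBracket, h.fderiv, h'.fderiv]
  refine Prod.ext ?_ ?_
  · simp [modelU, modelW, mul_comm]
  · simp [modelU, modelW]

/-- A connection represents the point `(a, b)` of the moduli curve `ab = 0` if it is locally
equivalent to `∇(a, b)`. -/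
def RepresentsModuliPoint {E : Type*} [NormedAddCommGroup E] [NormedSpace ℝ E]
    {H : Type*} [TopologicalSpace H] {I : ModelWithCorners ℝ E H}
    {M : Type*} [TopologicalSpace M] [ChartedSpace H M] [IsManifold I 1 M]
    (cov : CovariantDerivative I E (TangentSpace I : M → Type _)) (a b : ℝ) : Prop :=
  a * b = 0 ∧ LocallyEquivalent cov (modelConnection a b)

/-! ## The Lorentzian space of traceless endomorphisms and its future null cone -/

section Cone

/-- The connected component of the identity in a group `S` of linear automorphisms of a
normed space. -/
def identityComponent {W : Type*} [NormedAddCommGroup W] [NormedSpace ℝ W]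
    (S : Subgroup (W →L[ℝ] W)ˣ) : Subgroup (W →L[ℝ] W)ˣ :=
  (Subgroup.connectedComponentOfOne S).map S.subtype

variable (P : Type*) [NormedAddCommGroup P] [NormedSpace ℝ P]

/-- The space `V` of traceless endomorphisms of `P`. (For finite-dimensional `P` every linear
endomorphism is continuous; the operator norm only serves to make `V` a normed space.) -/
def TracelessEnd : Submodule ℝ (P →L[ℝ] P) :=
  LinearMap.ker ((LinearMap.trace ℝ P).comp (ContinuousLinearMap.coeLM ℝ))

/-- The Lorentzian quadratic form `⟨A, A⟩ = - det A` on `V`. -/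
def lorentzForm (A : TracelessEnd P) : ℝ := - LinearMap.det (A.1 : P →ₗ[ℝ] P)

/-- The Lorentz group of `V`: all linear automorphisms preserving the Lorentzian form. -/
def lorentzGroup : Subgroup (TracelessEnd P →L[ℝ] TracelessEnd P)ˣ where
  carrier := {T | ∀ A, lorentzForm P (T.1 A) = lorentzForm P A}
  mul_mem' := by
    intro S T hS hT A
    exact (hS (T.1 A)).trans (hT A)
  one_mem' := fun _ ↦ rfl
  inv_mem' := by
    intro T hT A
    have h := hT (T⁻¹.1 A)
    have h' : T.1 (T⁻¹.1 A) = A := congrArg (fun S ↦ S A) T.mul_inv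
    rw [h'] at h
    exact h.symm

/-- The identity component `SO↑(V)` of the Lorentz group. -/
def lorentzIdentityComponent : Subgroup (TracelessEnd P →L[ℝ] TracelessEnd P)ˣ :=
  identityComponent (W := TracelessEnd P) (lorentzGroup P)

variable {P}

/-- The future null cone determined by the area form `Ω`: the image of `P ∖ {0}` under the
quadratic map `Φ(y) = Ω(y, ·) ⊗ y`, that is, `Φ(y) z = Ω(y, z) y`. -/
def futureNullCone (Ω : LinearMap.BilinForm ℝ P) : Set (TracelessEnd P) :=
  {A | ∃ y : P, y ≠ 0 ∧ ∀ z, A.1 z = Ω y z • y}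

end Cone

end

/-! In a symplectic basis of the plane, a vector y becomes a complex number z, and suitable linear
coordinates (u, τ) of V turn the form into (|u|² - τ²)/4 and Φ(y) into (z², |z|²)
(`exists_isLorentzCoord`). So Σ is the graph τ = |u| over the punctured plane, u is a global chart
of it, and Φ is the double cover z ↦ u = z². Everything is done on the spinor plane and pushed down.

Let ω be the area form of the spinor plane. For a parameter d (which is c in the theorem) take there
the Christoffel symbol Γ(X, v) = d (ω(z, X) v + ω(z, v) X) - (d²/4) ω(z, X) ω(z, v) z. It is made of
z and ω alone, so every area-preserving linear map is affine for it, in particular -1; hence it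
descends to the chart u (`isAffineAt_planeSquare`). The first summand is a projective change of the
flat connection. Its curvature R(X, Y) Z is 3d ω(Y, X) Z plus d² ω(Y, X) ω(z, Z) z, and -d²/4 is
exactly the coefficient for which the second summand of Γ cancels the extra term. Curvature
operators are then multiples of the identity, and the Ricci tensor is an area form, nonzero when d ≠
0 (`coneChristoffel_curvature`, `ricci_coneConnection`).

Invariance: an element of the identity component keeps the time direction and the orientation of V,
since continuous functions without zeros on the Lorentz group keep their sign on the component. Such
an isometry is induced by an area-preserving map g of spinors (`exists_nullVector_lift`). Both g and
z ↦ z² are affine and the latter has surjective differential, so the induced map of Σ is affine as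
well, by cancellation (`IsAffineAt.of_comp`). Transitivity uses boosts, which rescale a null vector,
and rotations.

Moduli point: if ω(f, e) = 1, then (s, t) ↦ exp t · ((2/d)(s - s₀) e + f) is affine from ∇(1, 0) to
the half-plane ω(z, e) > 0 (`isAffineAt_modelParam`). A half-plane contains at most one of z and -z,
so squaring stays injective there, with an explicit smooth inverse `modelChart`. The choice of e, f
and s₀ makes any point of Σ correspond to any point of the group. -/

noncomputable section

/-! ## Manifolds with a global chart -/

section GlobalChart

set_option linter.unusedSectionVars false

variable {E : Type*} [NormedAddCommGroup E] [NormedSpace ℝ E]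
  {M : Type*} [TopologicalSpace M] [ChartedSpace E M]

/-- `φ` is a chart defined on all of `M`, and it is the preferred chart at every point. -/
structure IsGlobalChart (φ : OpenPartialHomeomorph M E) : Prop where
  source_eq : φ.source = Set.univ
  chartAt_eq : ∀ x, chartAt E x = φ

theorem isGlobalChart_refl : IsGlobalChart (OpenPartialHomeomorph.refl E) :=
  ⟨rfl, fun _ ↦ rfl⟩

/-- The coordinate expression of a vector field in a global chart. -/
def coordField (φ : OpenPartialHomeomorph M E) (X : Π z : M, TangentSpace 𝓘(ℝ, E) z) : E → E :=
  fun u ↦ X (φ.symm u)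

namespace IsGlobalChart

variable {φ : OpenPartialHomeomorph M E}

theorem mem_source (h : IsGlobalChart φ) (x : M) : x ∈ φ.source := h.source_eq ▸ Set.mem_univ x

theorem symm_apply (h : IsGlobalChart φ) (x : M) : φ.symm (φ x) = x := φ.left_inv (h.mem_source x)

theorem apply_mem_target (h : IsGlobalChart φ) (x : M) : φ x ∈ φ.target :=
  φ.map_source (h.mem_source x)

theorem target_mem_nhds (h : IsGlobalChart φ) (x : M) : φ.target ∈ 𝓝 (φ x) :=
  φ.open_target.mem_nhds (h.apply_mem_target x)

theorem continuousAt (h : IsGlobalChart φ) (x : M) : ContinuousAt φ x :=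
  φ.continuousAt (h.mem_source x)

theorem continuousAt_symm (h : IsGlobalChart φ) (x : M) : ContinuousAt φ.symm (φ x) :=
  φ.continuousAt_symm (h.apply_mem_target x)

theorem coordField_apply (h : IsGlobalChart φ) (X : Π z : M, TangentSpace 𝓘(ℝ, E) z) (x : M) :
    coordField φ X (φ x) = X x :=
  congrArg (fun z ↦ (show E from X z)) (h.symm_apply x)

theorem extChartAt_coe (h : IsGlobalChart φ) (x : M) : ⇑(extChartAt 𝓘(ℝ, E) x) = φ := by
  simp [extChartAt, h.chartAt_eq]

theorem extChartAt_symm_coe (h : IsGlobalChart φ) (x : M) :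
    ⇑(extChartAt 𝓘(ℝ, E) x).symm = φ.symm := by
  simp [extChartAt, h.chartAt_eq]

theorem eventually_symm (h : IsGlobalChart φ) {x : M} {p : M → Prop}
    (hp : ∀ᶠ z in 𝓝 x, p z) : ∀ᶠ u in 𝓝 (φ x), p (φ.symm u) :=
  (h.continuousAt_symm x).eventually (by rwa [h.symm_apply])

theorem eventually_apply_symm (h : IsGlobalChart φ) (x : M) :
    ∀ᶠ u in 𝓝 (φ x), φ (φ.symm u) = u := by
  filter_upwards [h.target_mem_nhds x] with u hu using φ.right_inv hu

section

variable {E' : Type*} [NormedAddCommGroup E'] [NormedSpace ℝ E']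
  {M' : Type*} [TopologicalSpace M'] [ChartedSpace E' M'] {ψ : OpenPartialHomeomorph M' E'}

/-- Smoothness of maps is smoothness in the global charts. -/
theorem contMDiffAt_iff (h : IsGlobalChart φ) (h' : IsGlobalChart ψ) {n : WithTop ℕ∞}
    {f : M → M'} {x : M} :
    ContMDiffAt 𝓘(ℝ, E) 𝓘(ℝ, E') n f x ↔
      ContinuousAt f x ∧ ContDiffAt ℝ n (ψ ∘ f ∘ φ.symm) (φ x) := by
  rw [_root_.contMDiffAt_iff, h.extChartAt_coe, h.extChartAt_symm_coe, h'.extChartAt_coe]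
  simp [contDiffWithinAt_univ]

theorem contMDiffAt_vector_iff (h : IsGlobalChart φ) {n : WithTop ℕ∞}
    {f : M → E'} {x : M} :
    ContMDiffAt 𝓘(ℝ, E) 𝓘(ℝ, E') n f x ↔ ContDiffAt ℝ n (f ∘ φ.symm) (φ x) := by
  rw [h.contMDiffAt_iff (isGlobalChart_refl (E := E'))]
  refine ⟨fun H ↦ H.2, fun H ↦ ⟨?_, H⟩⟩
  have := H.continuousAt.comp (h.continuousAt x)
  refine this.congr (Filter.Eventually.of_forall fun z ↦ ?_)
  simp [h.symm_apply]

theorem mdifferentiableAt_iff (h : IsGlobalChart φ) (h' : IsGlobalChart ψ)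
    {f : M → M'} {x : M} :
    MDifferentiableAt 𝓘(ℝ, E) 𝓘(ℝ, E') f x ↔
      ContinuousAt f x ∧ DifferentiableAt ℝ (ψ ∘ f ∘ φ.symm) (φ x) := by
  rw [_root_.mdifferentiableAt_iff, writtenInExtChartAt, h.extChartAt_coe, h.extChartAt_symm_coe,
    h'.extChartAt_coe]
  simp [differentiableWithinAt_univ]

theorem mdifferentiableAt_vector_iff (h : IsGlobalChart φ) {f : M → E'} {x : M} :
    MDifferentiableAt 𝓘(ℝ, E) 𝓘(ℝ, E') f x ↔ DifferentiableAt ℝ (f ∘ φ.symm) (φ x) := by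
  rw [h.mdifferentiableAt_iff (isGlobalChart_refl (E := E'))]
  refine ⟨fun H ↦ H.2, fun H ↦ ⟨?_, H⟩⟩
  have := H.continuousAt.comp (h.continuousAt x)
  refine this.congr (Filter.Eventually.of_forall fun z ↦ ?_)
  simp [h.symm_apply]

theorem mfderiv_eq (h : IsGlobalChart φ) (h' : IsGlobalChart ψ)
    {f : M → M'} {x : M} (hf : MDifferentiableAt 𝓘(ℝ, E) 𝓘(ℝ, E') f x) :
    mfderiv 𝓘(ℝ, E) 𝓘(ℝ, E') f x = fderiv ℝ (ψ ∘ f ∘ φ.symm) (φ x) := by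
  refine hf.mfderiv.trans ?_
  rw [writtenInExtChartAt, h.extChartAt_coe, h.extChartAt_symm_coe, h'.extChartAt_coe]
  simp [fderivWithin_univ]
  rfl

end

section TangentBundle

variable [IsManifold 𝓘(ℝ, E) 1 M]

/-- All preferred charts coincide, so the tangent coordinate change is the derivative of φ ∘ φ⁻¹,
the identity near φ z. Consequently vector fields on M are just functions with values in E, with no
change of frame. -/
theorem trivializationAt_apply (h : IsGlobalChart φ) (x z : M) (v : TangentSpace 𝓘(ℝ, E) z) :
    trivializationAt E (TangentSpace 𝓘(ℝ, E) : M → Type _) x ⟨z, v⟩ = (z, v) := by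
  rw [TangentBundle.trivializationAt_apply]
  have : fderivWithin ℝ ((chartAt E x).extend 𝓘(ℝ, E) ∘ ((chartAt E z).extend 𝓘(ℝ, E)).symm)
      (Set.range 𝓘(ℝ, E)) ((chartAt E z).extend 𝓘(ℝ, E) z) = ContinuousLinearMap.id ℝ E := by
    simp only [h.chartAt_eq, OpenPartialHomeomorph.extend_coe, modelWithCornersSelf_coe,
      OpenPartialHomeomorph.extend_coe_symm, modelWithCornersSelf_coe_symm, Set.range_id,
      fderivWithin_univ, Function.id_comp, Function.comp_id]
    have h1 : (φ ∘ φ.symm : E → E) =ᶠ[𝓝 (φ z)] id := h.eventually_apply_symm z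
    exact h1.fderiv_eq.trans fderiv_id
  exact Prod.ext rfl (congrArg (fun L : E →L[ℝ] E ↦ L v) this)

theorem mem_baseSet (h : IsGlobalChart φ) (x z : M) :
    z ∈ (trivializationAt E (TangentSpace 𝓘(ℝ, E) : M → Type _) x).baseSet := by
  rw [TangentBundle.trivializationAt_baseSet, h.chartAt_eq]
  exact h.mem_source z

theorem trivializationAt_symm (h : IsGlobalChart φ) (x z : M) (v : E) :
    (trivializationAt E (TangentSpace 𝓘(ℝ, E) : M → Type _) x).symm z v = v := by
  have h1 := (trivializationAt E (TangentSpace 𝓘(ℝ, E) : M → Type _) x).apply_mk_symm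
    (h.mem_baseSet x z) v
  rw [h.trivializationAt_apply] at h1
  exact congrArg Prod.snd h1

/-- Constant fields are thus the extensions that enter `ricci`; their brackets vanish, which reduces
the Ricci tensor to Christoffel symbols. -/
theorem extend_eq (h : IsGlobalChart φ) {x : M} (v : TangentSpace 𝓘(ℝ, E) x) (z : M) :
    FiberBundle.extend E v z = (show E from v) := by
  unfold FiberBundle.extend
  rw [h.trivializationAt_apply x x v, h.trivializationAt_symm]

theorem contMDiffAt_field_iff (h : IsGlobalChart φ) {n : WithTop ℕ∞}
    {X : Π z : M, TangentSpace 𝓘(ℝ, E) z} {x : M} :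
    ContMDiffAt 𝓘(ℝ, E) 𝓘(ℝ, E).tangent n (fun z ↦ (⟨z, X z⟩ : TangentBundle 𝓘(ℝ, E) M)) x ↔
      ContDiffAt ℝ n (coordField φ X) (φ x) := by
  rw [Bundle.contMDiffAt_section]
  simp only [h.trivializationAt_apply]
  exact h.contMDiffAt_vector_iff

theorem smoothFieldAt_iff (h : IsGlobalChart φ) {X : Π z : M, TangentSpace 𝓘(ℝ, E) z} {x : M} :
    SmoothFieldAt X x ↔ ContDiffAt ℝ ∞ (coordField φ X) (φ x) :=
  h.contMDiffAt_field_iff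

theorem mdifferentiableAt_field_iff (h : IsGlobalChart φ)
    {X : Π z : M, TangentSpace 𝓘(ℝ, E) z} {x : M} :
    MDifferentiableAt 𝓘(ℝ, E) 𝓘(ℝ, E).tangent (fun z ↦ (⟨z, X z⟩ : TangentBundle 𝓘(ℝ, E) M)) x ↔
      DifferentiableAt ℝ (coordField φ X) (φ x) := by
  rw [mdifferentiableAt_section]
  simp only [h.trivializationAt_apply]
  exact h.mdifferentiableAt_vector_iff

theorem inCoordinates_eq (h : IsGlobalChart φ) (x₀ x y₀ y : M)
    (A : TangentSpace 𝓘(ℝ, E) x →L[ℝ] TangentSpace 𝓘(ℝ, E) y) :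
    ContinuousLinearMap.inCoordinates E (TangentSpace 𝓘(ℝ, E) : M → Type _) E
      (TangentSpace 𝓘(ℝ, E) : M → Type _) x₀ x y₀ y A = A := by
  ext v
  rw [ContinuousLinearMap.inCoordinates_eq (h.mem_baseSet x₀ x) (h.mem_baseSet y₀ y)]
  have h1 : ∀ w : E, (trivializationAt E (TangentSpace 𝓘(ℝ, E) : M → Type _)
      y₀).continuousLinearEquivAt ℝ y (h.mem_baseSet y₀ y) w = w := fun w ↦
    (congrArg Prod.snd (h.trivializationAt_apply y₀ y w) :)
  have h2 : ((trivializationAt E (TangentSpace 𝓘(ℝ, E) : M → Type _)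
      x₀).continuousLinearEquivAt ℝ x (h.mem_baseSet x₀ x)).symm v = v :=
    h.trivializationAt_symm x₀ x v
  exact (h1 _).trans (congrArg A h2)

theorem contMDiffAt_hom_iff (h : IsGlobalChart φ) {n : WithTop ℕ∞}
    {A : Π z : M, TangentSpace 𝓘(ℝ, E) z →L[ℝ] TangentSpace 𝓘(ℝ, E) z} {x : M} :
    ContMDiffAt 𝓘(ℝ, E) (𝓘(ℝ, E).prod 𝓘(ℝ, E →L[ℝ] E)) n
      (fun z ↦ (⟨z, A z⟩ : Bundle.TotalSpace (E →L[ℝ] E)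
        fun z : M ↦ TangentSpace 𝓘(ℝ, E) z →L[ℝ] TangentSpace 𝓘(ℝ, E) z)) x ↔
      ContDiffAt ℝ n (F := E →L[ℝ] E) (fun u ↦ A (φ.symm u)) (φ x) := by
  rw [contMDiffAt_hom_bundle]
  have : ∀ z, ContinuousLinearMap.inCoordinates E (TangentSpace 𝓘(ℝ, E) : M → Type _) E
      (TangentSpace 𝓘(ℝ, E) : M → Type _) x z x z (A z) = A z := fun z ↦ h.inCoordinates_eq ..
  simp only [this]
  exact (and_iff_right contMDiffAt_id).trans h.contMDiffAt_vector_iff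

/-- The manifold bracket is a pullback of the flat bracket along the chart, and both φ and φ⁻¹ have
identity differential because M is itself read in φ. -/
theorem mlieBracket_eq_lieBracket (h : IsGlobalChart φ) (X Y : Π z : M, TangentSpace 𝓘(ℝ, E) z) (x : M) :
    VectorField.mlieBracket 𝓘(ℝ, E) X Y x =
      VectorField.lieBracket ℝ (coordField φ X) (coordField φ Y) (φ x) := by
  have hd : ∀ z, MDifferentiableAt 𝓘(ℝ, E) 𝓘(ℝ, E) φ z := fun z ↦ by
    rw [h.mdifferentiableAt_vector_iff]
    exact differentiableAt_id.congr_of_eventuallyEq (h.eventually_apply_symm z)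
  have hm : ∀ z, mfderiv 𝓘(ℝ, E) 𝓘(ℝ, E) φ z = ContinuousLinearMap.id ℝ E := fun z ↦ by
    rw [h.mfderiv_eq isGlobalChart_refl (hd z)]
    have h1 : (OpenPartialHomeomorph.refl E ∘ φ ∘ φ.symm : E → E) =ᶠ[𝓝 (φ z)] id :=
      h.eventually_apply_symm z
    exact h1.fderiv_eq.trans fderiv_id
  have hs : ∀ u ∈ φ.target, mfderiv 𝓘(ℝ, E) 𝓘(ℝ, E) φ.symm u = ContinuousLinearMap.id ℝ E := by
    intro u hu
    have h0 : φ (φ.symm u) = u := φ.right_inv hu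
    have h1 : (φ ∘ φ.symm ∘ (OpenPartialHomeomorph.refl E).symm : E → E) =ᶠ[𝓝 u] id := by
      filter_upwards [φ.open_target.mem_nhds hu] with w hw using φ.right_inv hw
    have h2 : MDifferentiableAt 𝓘(ℝ, E) 𝓘(ℝ, E) φ.symm u := by
      rw [isGlobalChart_refl.mdifferentiableAt_iff h]
      exact ⟨φ.continuousAt_symm hu, differentiableAt_id.congr_of_eventuallyEq h1⟩
    rw [isGlobalChart_refl.mfderiv_eq h h2]
    exact h1.fderiv_eq.trans fderiv_id
  have hp : ∀ Z : Π z : M, TangentSpace 𝓘(ℝ, E) z,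
      (VectorField.mpullback 𝓘(ℝ, E) 𝓘(ℝ, E) φ.symm Z : E → E) =ᶠ[𝓝 (φ x)]
        coordField φ Z := by
    intro Z
    filter_upwards [h.target_mem_nhds x] with u hu
    rw [VectorField.mpullback_apply, hs u hu]
    exact congrArg (fun L : E →L[ℝ] E ↦ L (Z (φ.symm u))) ContinuousLinearMap.inverse_id
  have key : ∀ L : E →L[ℝ] E, mfderiv 𝓘(ℝ, E) 𝓘(ℝ, E) φ x = L →
      VectorField.mlieBracket 𝓘(ℝ, E) X Y x = L.inverse
      (VectorField.lieBracket ℝ (VectorField.mpullback 𝓘(ℝ, E) 𝓘(ℝ, E) φ.symm X : E → E)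
        (VectorField.mpullback 𝓘(ℝ, E) 𝓘(ℝ, E) φ.symm Y : E → E) (φ x)) := by
    rintro L rfl
    rw [VectorField.mlieBracket, VectorField.mlieBracketWithin_def]
    simp only [h.extChartAt_coe, h.extChartAt_symm_coe]
    refine VectorField.mpullback_apply.trans ?_
    have h1 : ∀ (V W V' W' : E → E) (s : Set E), V = V' → W = W' → s = Set.univ →
        VectorField.lieBracketWithin ℝ V W s (φ x) = VectorField.lieBracket ℝ V' W' (φ x) := by
      rintro V W V' W' s rfl rfl rfl
      rw [VectorField.lieBracketWithin_univ]
    refine congrArg (mfderiv 𝓘(ℝ, E) 𝓘(ℝ, E) φ x).inverse (h1 _ _ _ _ _ ?_ ?_ (by simp))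
    · simp only [modelWithCornersSelf_coe, Set.range_id, VectorField.mpullbackWithin_univ]
      rfl
    · simp only [modelWithCornersSelf_coe, Set.range_id, VectorField.mpullbackWithin_univ]
      rfl
  rw [key _ (hm x), (hp X).lieBracket_vectorField_eq (hp Y), ContinuousLinearMap.inverse_id]
  rfl

theorem mlieBracket_eq (h : IsGlobalChart φ) (X Y : Π z : M, TangentSpace 𝓘(ℝ, E) z) (x : M) :
    VectorField.mlieBracket 𝓘(ℝ, E) X Y x =
      fderiv ℝ (coordField φ Y) (φ x) (coordField φ X (φ x)) -
        fderiv ℝ (coordField φ X) (φ x) (coordField φ Y (φ x)) := by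
  rw [h.mlieBracket_eq_lieBracket, VectorField.lieBracket_eq]

end TangentBundle

end IsGlobalChart

end GlobalChart

/-! ## Connections given by Christoffel symbols -/

section Christoffel

variable {E : Type*} [NormedAddCommGroup E] [NormedSpace ℝ E]
  {E' : Type*} [NormedAddCommGroup E'] [NormedSpace ℝ E']
  {E'' : Type*} [NormedAddCommGroup E''] [NormedSpace ℝ E'']

/-- The affine-map equation at `u` for a map `F` between domains of normed spaces with Christoffel
symbols `Γ`, `Γ'` (where `Γ u X v` is the correction term of `∇_v X`). -/
def IsAffineAt (Γ : E → E →L[ℝ] E →L[ℝ] E) (Γ' : E' → E' →L[ℝ] E' →L[ℝ] E') (F : E → E')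
    (u : E) : Prop :=
  ∀ X v, fderiv ℝ F u (Γ u X v) =
    fderiv ℝ (fderiv ℝ F) u v X + Γ' (F u) (fderiv ℝ F u X) (fderiv ℝ F u v)

/-- Second-order chain rule, the only analytic input for composing and cancelling affine maps. -/
theorem fderiv_fderiv_comp {G : E' → E''} {F : E → E'} {u : E} (hG : ContDiffAt ℝ 2 G (F u))
    (hF : ContDiffAt ℝ 2 F u) (v X : E) :
    fderiv ℝ (fderiv ℝ (G ∘ F)) u v X =
      fderiv ℝ (fderiv ℝ G) (F u) (fderiv ℝ F u v) (fderiv ℝ F u X) +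
        fderiv ℝ G (F u) (fderiv ℝ (fderiv ℝ F) u v X) := by
  have hG1 : ∀ᶠ w in 𝓝 u, DifferentiableAt ℝ G (F w) := by
    have := hG.eventually (by simp)
    filter_upwards [hF.continuousAt.eventually this] with w hw using hw.differentiableAt (by simp)
  have hF1 : ∀ᶠ w in 𝓝 u, DifferentiableAt ℝ F w := by
    filter_upwards [hF.eventually (by simp)] with w hw using hw.differentiableAt (by simp)
  have h1 : fderiv ℝ (G ∘ F) =ᶠ[𝓝 u] fun w ↦ (fderiv ℝ G (F w)).comp (fderiv ℝ F w) := by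
    filter_upwards [hG1, hF1] with w h1 h2 using fderiv_comp w h1 h2
  have hG2 : DifferentiableAt ℝ (fderiv ℝ G) (F u) :=
    (hG.fderiv_right (m := 1) (by norm_num)).differentiableAt (by simp)
  have hF2 : DifferentiableAt ℝ (fderiv ℝ F) u :=
    (hF.fderiv_right (m := 1) (by norm_num)).differentiableAt (by simp)
  have hF0 : DifferentiableAt ℝ F u := hF1.self_of_nhds
  have h2 := (hG2.hasFDerivAt.comp u hF0.hasFDerivAt).clm_comp hF2.hasFDerivAt
  rw [h1.fderiv_eq]
  refine (congrArg (fun L : E →L[ℝ] E →L[ℝ] E'' ↦ L v X) h2.fderiv).trans ?_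
  simp [add_comm]

variable {Γ : E → E →L[ℝ] E →L[ℝ] E} {Γ' : E' → E' →L[ℝ] E' →L[ℝ] E'}
  {Γ'' : E'' → E'' →L[ℝ] E'' →L[ℝ] E''}

theorem IsAffineAt.comp {G : E' → E''} {F : E → E'} {u : E} (hG : ContDiffAt ℝ 2 G (F u))
    (hF : ContDiffAt ℝ 2 F u) (hG' : IsAffineAt Γ' Γ'' G (F u)) (hF' : IsAffineAt Γ Γ' F u) :
    IsAffineAt Γ Γ'' (G ∘ F) u := by
  intro X v
  rw [fderiv_fderiv_comp hG hF, fderiv_comp u (hG.differentiableAt (by simp))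
    (hF.differentiableAt (by simp))]
  simp only [ContinuousLinearMap.comp_apply, Function.comp_apply]
  rw [hF' X v, map_add, hG']
  abel

/-- If `F` is affine with surjective differential and `G ∘ F` is affine, then `G` is affine. -/
theorem IsAffineAt.of_comp {G : E' → E''} {F : E → E'} {u : E} (hG : ContDiffAt ℝ 2 G (F u))
    (hF : ContDiffAt ℝ 2 F u) (hF' : IsAffineAt Γ Γ' F u)
    (hsurj : Function.Surjective (fderiv ℝ F u)) (hGF : IsAffineAt Γ Γ'' (G ∘ F) u) :
    IsAffineAt Γ' Γ'' G (F u) := by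
  intro X v
  obtain ⟨X, rfl⟩ := hsurj X
  obtain ⟨v, rfl⟩ := hsurj v
  have := hGF X v
  rw [fderiv_fderiv_comp hG hF, fderiv_comp u (hG.differentiableAt (by simp))
    (hF.differentiableAt (by simp))] at this
  simp only [ContinuousLinearMap.comp_apply, Function.comp_apply] at this
  rw [hF' X v, map_add] at this
  rw [← sub_eq_zero] at this ⊢
  rw [← this]
  abel

theorem IsAffineAt.congr {F G : E → E'} {u : E} (hF : IsAffineAt Γ Γ' F u)
    (h : F =ᶠ[𝓝 u] G) : IsAffineAt Γ Γ' G u := by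
  intro X v
  rw [← h.fderiv_eq, ← h.fderiv.fderiv_eq, ← h.eq_of_nhds]
  exact hF X v

theorem isAffineAt_id (u : E) : IsAffineAt Γ Γ id u := by
  intro X v
  have : fderiv ℝ (id : E → E) = fun _ ↦ ContinuousLinearMap.id ℝ E := by
    funext w; exact fderiv_id
  rw [this]
  simp

/-- The curvature `R(X, Y) Z = ∇_Y ∇_X Z - ∇_X ∇_Y Z` of constant vector fields. -/
def christoffelCurvature (Γ : E → E →L[ℝ] E →L[ℝ] E) (u X Y Z : E) : E :=
  (fderiv ℝ (fun w ↦ Γ w Z X) u Y + Γ u (Γ u Z X) Y) -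
    (fderiv ℝ (fun w ↦ Γ w Z Y) u X + Γ u (Γ u Z Y) X)

variable {M : Type*} [TopologicalSpace M] [ChartedSpace E M] {φ : OpenPartialHomeomorph M E}
  {M' : Type*} [TopologicalSpace M'] [ChartedSpace E' M'] {ψ : OpenPartialHomeomorph M' E'}

/-- `Γ` is the Christoffel symbol of the connection `cov` in the global chart `φ`. -/
def HasChristoffel [IsManifold 𝓘(ℝ, E) 1 M]
    (cov : CovariantDerivative 𝓘(ℝ, E) E (TangentSpace 𝓘(ℝ, E) : M → Type _))
    (φ : OpenPartialHomeomorph M E) (Γ : E → E →L[ℝ] E →L[ℝ] E) : Prop :=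
  ∀ (X : Π z : M, TangentSpace 𝓘(ℝ, E) z) (x : M),
    DifferentiableAt ℝ (coordField φ X) (φ x) →
    ∀ v : E, cov X x v =
      fderiv ℝ (coordField φ X) (φ x) v + Γ (φ x) (coordField φ X (φ x)) v

/-- The coordinate expression of the covariant derivative of a vector field. -/
def christoffelDeriv (Γ : E → E →L[ℝ] E →L[ℝ] E) (X : E → E) (u : E) : E →L[ℝ] E :=
  fderiv ℝ X u + Γ u (X u)

theorem christoffelDeriv_apply (Γ : E → E →L[ℝ] E →L[ℝ] E) (X : E → E) (u v : E) :
    christoffelDeriv Γ X u v = fderiv ℝ X u v + Γ u (X u) v := rfl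

theorem christoffelDeriv_add {X Y : E → E} {u : E} (hX : DifferentiableAt ℝ X u)
    (hY : DifferentiableAt ℝ Y u) :
    christoffelDeriv Γ (X + Y) u = christoffelDeriv Γ X u + christoffelDeriv Γ Y u := by
  rw [christoffelDeriv, christoffelDeriv, christoffelDeriv, fderiv_add hX hY, Pi.add_apply, map_add]
  abel

theorem christoffelDeriv_smul {X : E → E} {g : E → ℝ} {u : E} (hX : DifferentiableAt ℝ X u)
    (hg : DifferentiableAt ℝ g u) :
    christoffelDeriv Γ (fun w ↦ g w • X w) u =
      g u • christoffelDeriv Γ X u + (fderiv ℝ g u).smulRight (X u) := by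
  rw [christoffelDeriv, christoffelDeriv, fderiv_fun_smul hg hX, map_smul, smul_add]
  abel

/-- Differentiating the relation dF(X) = Y ∘ F in the direction v gives D²F(v, X) + dF(D_v X) =
D_{dF v} Y; the affine equation trades the second derivative for the two Christoffel terms. -/
theorem IsAffineAt.christoffelDeriv {F : E → E'} {u : E} (hF : ContDiffAt ℝ 2 F u)
    (hA : IsAffineAt Γ Γ' F u) {X : E → E} {Y : E' → E'} (hX : DifferentiableAt ℝ X u)
    (hY : DifferentiableAt ℝ Y (F u)) (hXY : (fun w ↦ fderiv ℝ F w (X w)) =ᶠ[𝓝 u] Y ∘ F) (v : E) :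
    fderiv ℝ F u (christoffelDeriv Γ X u v) = christoffelDeriv Γ' Y (F u) (fderiv ℝ F u v) := by
  have hF2 : DifferentiableAt ℝ (fderiv ℝ F) u :=
    (hF.fderiv_right (m := 1) (by norm_num)).differentiableAt (by simp)
  have hF1 : DifferentiableAt ℝ F u := hF.differentiableAt (by simp)
  have hd := hXY.fderiv_eq (𝕜 := ℝ)
  rw [(hF2.hasFDerivAt.clm_apply hX.hasFDerivAt).fderiv, fderiv_comp _ hY hF1] at hd
  have hdv := congrArg (fun L : E →L[ℝ] E' ↦ L v) hd
  simp only [add_apply, ContinuousLinearMap.comp_apply, ContinuousLinearMap.flip_apply] at hdv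
  have e0 : fderiv ℝ F u (X u) = Y (F u) := hXY.eq_of_nhds
  have e5 := hA (X u) v
  rw [e0] at e5
  rw [christoffelDeriv_apply, christoffelDeriv_apply, map_add, e5, ← hdv]
  abel

variable [IsManifold 𝓘(ℝ, E) 1 M] [IsManifold 𝓘(ℝ, E') 1 M']

/-- The connection with prescribed Christoffel symbol in a global chart. -/
def christoffelConnection (h : IsGlobalChart φ) (Γ : E → E →L[ℝ] E →L[ℝ] E) :
    CovariantDerivative 𝓘(ℝ, E) E (TangentSpace 𝓘(ℝ, E) : M → Type _) where
  toFun X x := christoffelDeriv (E := E) Γ (coordField φ X) (φ x)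
  isCovariantDerivativeOnUniv :=
    { add := by
        intro X Y x hX hY _
        exact christoffelDeriv_add (h.mdifferentiableAt_field_iff.1 hX)
          (h.mdifferentiableAt_field_iff.1 hY)
      leibniz := by
        intro X g x hX hg _
        have hX' := h.mdifferentiableAt_field_iff.1 hX
        have hg' := h.mdifferentiableAt_vector_iff.1 hg
        have hm : ∀ v : E, mvfderiv 𝓘(ℝ, E) g x v = fderiv ℝ (g ∘ φ.symm) (φ x) v :=
          fun v ↦ congrArg (fun L : E →L[ℝ] ℝ ↦ L v) (h.mfderiv_eq isGlobalChart_refl hg)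
        have e := christoffelDeriv_smul (Γ := Γ) hX' hg'
        rw [h.coordField_apply, Function.comp_apply, h.symm_apply] at e
        refine ContinuousLinearMap.ext fun v ↦ ?_
        refine (congrArg (fun L : E →L[ℝ] E ↦ L v) e).trans ?_
        exact congrArg (fun t : ℝ ↦ g x • christoffelDeriv Γ (coordField φ X) (φ x) v +
          t • (show E from X x)) (hm v).symm }

theorem christoffelConnection_apply (h : IsGlobalChart φ) (Γ : E → E →L[ℝ] E →L[ℝ] E)
    (X : Π z : M, TangentSpace 𝓘(ℝ, E) z) (x : M) (v : E) :
    christoffelConnection h Γ X x v =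
      fderiv ℝ (coordField φ X) (φ x) v + Γ (φ x) (coordField φ X (φ x)) v := rfl

theorem hasChristoffel_christoffelConnection (h : IsGlobalChart φ)
    (Γ : E → E →L[ℝ] E →L[ℝ] E) : HasChristoffel (christoffelConnection h Γ) φ Γ :=
  fun _ _ _ _ ↦ rfl

theorem contMDiff_christoffelConnection (h : IsGlobalChart φ) (hΓ : ContDiffOn ℝ ∞ Γ φ.target) :
    CovariantDerivative.ContMDiffCovariantDerivative (christoffelConnection h Γ) ∞ := by
  refine ⟨⟨fun {X} hX ↦ ?_⟩⟩
  rw [contMDiffOn_univ] at hX ⊢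
  intro x
  have hX' : ContDiffAt ℝ ∞ (coordField φ X) (φ x) := h.contMDiffAt_field_iff.1 (hX x)
  refine h.contMDiffAt_hom_iff.2 ?_
  have h1 : ContDiffAt ℝ ∞ (christoffelDeriv Γ (coordField φ X)) (φ x) :=
    (hX'.fderiv_right (by simp)).add
      ((hΓ.contDiffAt (h.target_mem_nhds x)).clm_apply hX')
  refine h1.congr_of_eventuallyEq ?_
  filter_upwards [h.eventually_apply_symm x] with u hu
  exact congrArg (christoffelDeriv Γ (coordField φ X)) hu

theorem torsion_christoffelConnection [FiniteDimensional ℝ E] [IsManifold 𝓘(ℝ, E) 2 M]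
    (h : IsGlobalChart φ) (hΓ : ∀ u X Y, Γ u X Y = Γ u Y X) :
    (christoffelConnection h Γ).torsion = 0 := by
  have : CompleteSpace E := FiniteDimensional.complete ℝ E
  rw [CovariantDerivative.torsion_eq_zero_iff]
  intro X Y x hX hY
  rw [h.mlieBracket_eq, ← h.coordField_apply X x, ← h.coordField_apply Y x,
    christoffelConnection_apply, christoffelConnection_apply, hΓ _ (coordField φ X (φ x))]
  exact add_sub_add_right_eq_sub _ _ _

/-- Vectors are extended by constant fields: the derivative of a constant field is the Christoffel
term alone, and the bracket term of the curvature drops out. -/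
theorem ricci_christoffelConnection [FiniteDimensional ℝ E] (h : IsGlobalChart φ)
    (x : M) (v z : E) :
    ricci (christoffelConnection h Γ) x v z = ∑ i, (Module.finBasis ℝ E).coord i
      (christoffelCurvature Γ (φ x) v (Module.finBasis ℝ E i) z) := by
  unfold ricci
  refine Finset.sum_congr rfl fun i _ ↦ congrArg _ ?_
  have he : ∀ w : E, (FiberBundle.extend E (show TangentSpace 𝓘(ℝ, E) x from w)) =
    (fun y : M ↦ (show TangentSpace 𝓘(ℝ, E) y from w)) := fun w ↦ funext fun y ↦ h.extend_eq w y
  have hc : ∀ (a b : E) (y : M),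
      christoffelConnection h Γ (fun y : M ↦ (show TangentSpace 𝓘(ℝ, E) y from a)) y b =
        Γ (φ y) a b := by
    intro a b y
    refine (christoffelConnection_apply ..).trans ?_
    have : coordField φ (fun y : M ↦ (show TangentSpace 𝓘(ℝ, E) y from a)) = fun _ ↦ a := rfl
    rw [this]
    simp
    rfl
  have hd : ∀ (a b c : E), christoffelConnection h Γ
      (fun y : M ↦ (show TangentSpace 𝓘(ℝ, E) y from Γ (φ y) a b)) x c =
      fderiv ℝ (fun u ↦ Γ u a b) (φ x) c + Γ (φ x) (Γ (φ x) a b) c := by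
    intro a b c
    refine (christoffelConnection_apply ..).trans ?_
    have : coordField φ (fun y : M ↦ (show TangentSpace 𝓘(ℝ, E) y from Γ (φ y) a b))
        =ᶠ[𝓝 (φ x)] fun u ↦ Γ u a b := by
      filter_upwards [h.eventually_apply_symm x] with u hu
      exact congrArg (fun w ↦ Γ w a b) hu
    rw [this.fderiv_eq, this.eq_of_nhds]
  have key : ∀ a b c : E, curvatureField (christoffelConnection h Γ)
      (fun y : M ↦ (show TangentSpace 𝓘(ℝ, E) y from a))
      (fun y : M ↦ (show TangentSpace 𝓘(ℝ, E) y from b))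
      (fun y : M ↦ (show TangentSpace 𝓘(ℝ, E) y from c)) x =
      christoffelCurvature Γ (φ x) a b c := by
    intro a b c
    have e1 : christoffelConnection h Γ (fun y : M ↦ christoffelConnection h Γ
        (fun y : M ↦ (show TangentSpace 𝓘(ℝ, E) y from c)) y a) x b = _ :=
      (congrArg (fun W : Π y : M, TangentSpace 𝓘(ℝ, E) y ↦ christoffelConnection h Γ W x b)
        (funext (hc c a))).trans (hd c a b)
    have e2 : christoffelConnection h Γ (fun y : M ↦ christoffelConnection h Γ
        (fun y : M ↦ (show TangentSpace 𝓘(ℝ, E) y from c)) y b) x a = _ :=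
      (congrArg (fun W : Π y : M, TangentSpace 𝓘(ℝ, E) y ↦ christoffelConnection h Γ W x a)
        (funext (hc c b))).trans (hd c b a)
    have e3 : VectorField.mlieBracket 𝓘(ℝ, E)
        (fun y : M ↦ (show TangentSpace 𝓘(ℝ, E) y from a))
        (fun y : M ↦ (show TangentSpace 𝓘(ℝ, E) y from b)) x = 0 := by
      rw [h.mlieBracket_eq]
      have : ∀ a : E, coordField φ (fun y : M ↦ (show TangentSpace 𝓘(ℝ, E) y from a)) =
        fun _ ↦ a := fun _ ↦ rfl
      rw [this, this]
      simp
      rfl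
    refine (congrArg₂ (· + ·) (congrArg₂ (· - ·) e1 e2)
      ((congrArg _ e3).trans (map_zero _))).trans ?_
    exact add_zero _
  refine Eq.trans ?_ (key v (Module.finBasis ℝ E i) z)
  rw [← he, ← he, ← he]

/-- Passage from the pointwise equation in charts to the intrinsic notion. Differentiability of f
near x, not only at x, is needed because relatedness of the fields is differentiated. -/
theorem intertwinesAt_of_isAffineAt (h : IsGlobalChart φ) (h' : IsGlobalChart ψ)
    {cov : CovariantDerivative 𝓘(ℝ, E) E (TangentSpace 𝓘(ℝ, E) : M → Type _)}
    {cov' : CovariantDerivative 𝓘(ℝ, E') E' (TangentSpace 𝓘(ℝ, E') : M' → Type _)}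
    (hc : HasChristoffel cov φ Γ) (hc' : HasChristoffel cov' ψ Γ') {f : M → M'} {x : M}
    (hf : ContMDiffAt 𝓘(ℝ, E) 𝓘(ℝ, E') ∞ f x)
    (hf' : ∀ᶠ z in 𝓝 x, MDifferentiableAt 𝓘(ℝ, E) 𝓘(ℝ, E') f z)
    (hA : IsAffineAt Γ Γ' (ψ ∘ f ∘ φ.symm) (φ x)) : IntertwinesAt cov cov' f x := by
  intro X Y hX hY hXY v
  set F := ψ ∘ f ∘ φ.symm with hFdef
  have hFx : F (φ x) = ψ (f x) := by simp [hFdef, h.symm_apply]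
  have hF : ContDiffAt ℝ ∞ F (φ x) := ((h.contMDiffAt_iff h').1 hf).2
  have hX' := (h.smoothFieldAt_iff.1 hX).differentiableAt (by simp)
  have hY' := (h'.smoothFieldAt_iff.1 hY).differentiableAt (by simp)
  have hrel : (fun u ↦ fderiv ℝ F u (coordField φ X u)) =ᶠ[𝓝 (φ x)] coordField ψ Y ∘ F := by
    filter_upwards [h.eventually_symm hf', h.eventually_symm hXY, h.eventually_apply_symm x]
      with u h1 h2 h3
    have h4 : mfderiv 𝓘(ℝ, E) 𝓘(ℝ, E') f (φ.symm u) (X (φ.symm u)) =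
        fderiv ℝ F (φ (φ.symm u)) (coordField φ X u) :=
      congrArg (fun L : E →L[ℝ] E' ↦ L (X (φ.symm u))) (h.mfderiv_eq h' h1)
    have h5 : coordField ψ Y (F u) = Y (f (φ.symm u)) := h'.coordField_apply Y _
    rw [h3] at h4
    rw [Function.comp_apply, h5, ← h2, h4]
  have hm := h.mfderiv_eq h' hf'.self_of_nhds
  have e1 : mfderiv 𝓘(ℝ, E) 𝓘(ℝ, E') f x (cov X x v) = fderiv ℝ F (φ x) (cov X x v) :=
    congrArg (fun L : E →L[ℝ] E' ↦ L (cov X x v)) hm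
  have e2 : mfderiv 𝓘(ℝ, E) 𝓘(ℝ, E') f x v = fderiv ℝ F (φ x) v :=
    congrArg (fun L : E →L[ℝ] E' ↦ L v) hm
  rw [e1, e2]
  refine (congrArg (fderiv ℝ F (φ x)) (hc X x hX' v)).trans
    (Eq.trans ?_ (hc' Y (f x) hY' (fderiv ℝ F (φ x) v)).symm)
  have hF2 : ContDiffAt ℝ 2 F (φ x) := hF.of_le ENat.LEInfty.out
  have := hA.christoffelDeriv hF2 hX' (by rwa [hFx]) hrel v
  rwa [hFx] at this

theorem isAffineDiffeoAt_of_isAffineAt (h : IsGlobalChart φ) (h' : IsGlobalChart ψ)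
    {cov : CovariantDerivative 𝓘(ℝ, E) E (TangentSpace 𝓘(ℝ, E) : M → Type _)}
    {cov' : CovariantDerivative 𝓘(ℝ, E') E' (TangentSpace 𝓘(ℝ, E') : M' → Type _)}
    (hc : HasChristoffel cov φ Γ) (hc' : HasChristoffel cov' ψ Γ') {f : M → M'} {x : M}
    (D : PartialDiffeomorph 𝓘(ℝ, E) 𝓘(ℝ, E') M M' ∞) (hx : x ∈ D.source)
    (hf : Set.EqOn f D D.source)
    (hA : ∀ z ∈ D.source, IsAffineAt Γ Γ' (ψ ∘ f ∘ φ.symm) (φ z)) :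
    IsAffineDiffeoAt cov cov' f x := by
  refine ⟨⟨D, hx, hf⟩, ?_⟩
  filter_upwards [D.open_source.mem_nhds hx] with z hz
  have hn : (∞ : WithTop ℕ∞) ≠ 0 := by simp
  have hs : ∀ z ∈ D.source, ContMDiffAt 𝓘(ℝ, E) 𝓘(ℝ, E') ∞ f z := fun z hz ↦
    ((D.contMDiffOn_toFun.congr hf) z hz).contMDiffAt (D.open_source.mem_nhds hz)
  refine intertwinesAt_of_isAffineAt h h' hc hc' (hs z hz) ?_ (hA z hz)
  filter_upwards [D.open_source.mem_nhds hz] with w hw using (hs w hw).mdifferentiableAt hn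

end Christoffel

/-! ## The invariant connections on the punctured plane -/

section Plane

/-- The Euclidean plane. -/
abbrev Plane := EuclideanSpace ℝ (Fin 2)

/-- The symmetric bilinear map on the plane with prescribed values `a`, `b`, `c` on the pairs
`(e₀, e₀)`, `(e₀, e₁)`, `(e₁, e₁)`. -/
def symBilin (a b c : Plane) : Plane →L[ℝ] Plane →L[ℝ] Plane :=
  (EuclideanSpace.proj 0 : Plane →L[ℝ] ℝ).smulRight
      ((EuclideanSpace.proj 0 : Plane →L[ℝ] ℝ).smulRight a +
        (EuclideanSpace.proj 1 : Plane →L[ℝ] ℝ).smulRight b) +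
    (EuclideanSpace.proj 1 : Plane →L[ℝ] ℝ).smulRight
      ((EuclideanSpace.proj 0 : Plane →L[ℝ] ℝ).smulRight b +
        (EuclideanSpace.proj 1 : Plane →L[ℝ] ℝ).smulRight c)

theorem symBilin_apply (a b c X v : Plane) :
    symBilin a b c X v =
      (X 0 * v 0) • a + (X 0 * v 1 + X 1 * v 0) • b + (X 1 * v 1) • c := by
  simp [symBilin]
  module

theorem symBilin_symm (a b c X v : Plane) : symBilin a b c X v = symBilin a b c v X := by
  rw [symBilin_apply, symBilin_apply, mul_comm (X 0), mul_comm (X 1) (v 1), mul_comm (X 1),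
    mul_comm (X 0), add_comm (v 1 * X 0)]

theorem ContDiffAt.symBilin {E : Type*} [NormedAddCommGroup E] [NormedSpace ℝ E] {n : WithTop ℕ∞}
    {a b c : E → Plane} {x : E} (ha : ContDiffAt ℝ n a x) (hb : ContDiffAt ℝ n b x)
    (hc : ContDiffAt ℝ n c x) : ContDiffAt ℝ n (fun y ↦ symBilin (a y) (b y) (c y)) x := by
  unfold _root_.symBilin
  fun_prop

theorem ContDiffAt.vec2 {E : Type*} [NormedAddCommGroup E] [NormedSpace ℝ E] {n : WithTop ℕ∞}
    {a b : E → ℝ} {x : E} (ha : ContDiffAt ℝ n a x) (hb : ContDiffAt ℝ n b x) :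
    ContDiffAt ℝ n (fun y ↦ (!₂[a y, b y] : Plane)) x := by
  rw [contDiffAt_euclidean]
  intro i
  fin_cases i
  · exact ha
  · exact hb

/-- The Christoffel symbol of the connection `∇^d`, read in the squaring chart of the cone;
`s` stands for the inverse of the norm of `u`. -/
def coneCoeff (d s : ℝ) (u : Plane) : Plane →L[ℝ] Plane →L[ℝ] Plane :=
  symBilin
    !₂[-(s ^ 2 / 2) * u 0 - d ^ 2 * s ^ 2 / 8 * u 1 ^ 2 * u 0 - d * s * u 1,
      s ^ 2 / 2 * u 1 - d ^ 2 * s ^ 2 / 8 * u 1 ^ 2 * u 1]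
    !₂[-(s ^ 2 / 2) * u 1 + d ^ 2 * s ^ 2 / 8 * (u 0 * u 1) * u 0 + d * s / 2 * u 0,
      -(s ^ 2 / 2) * u 0 + d ^ 2 * s ^ 2 / 8 * (u 0 * u 1) * u 1 - d * s / 2 * u 1]
    !₂[s ^ 2 / 2 * u 0 - d ^ 2 * s ^ 2 / 8 * u 0 ^ 2 * u 0,
      -(s ^ 2 / 2) * u 1 - d ^ 2 * s ^ 2 / 8 * u 0 ^ 2 * u 1 + d * s * u 0]

/-- The Christoffel symbol of the connection `∇^d` in the squaring chart of the cone. -/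
def coneChristoffel (d : ℝ) (u : Plane) : Plane →L[ℝ] Plane →L[ℝ] Plane := coneCoeff d ‖u‖⁻¹ u

theorem coneCoeff_apply_zero (d s : ℝ) (u X v : Plane) : coneCoeff d s u X v 0 =
    X 0 * v 0 * (-(s ^ 2 / 2) * u 0 - d ^ 2 * s ^ 2 / 8 * u 1 ^ 2 * u 0 - d * s * u 1) +
    (X 0 * v 1 + X 1 * v 0) *
      (-(s ^ 2 / 2) * u 1 + d ^ 2 * s ^ 2 / 8 * (u 0 * u 1) * u 0 + d * s / 2 * u 0) +
    X 1 * v 1 * (s ^ 2 / 2 * u 0 - d ^ 2 * s ^ 2 / 8 * u 0 ^ 2 * u 0) := by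
  simp [coneCoeff, symBilin_apply]

theorem coneCoeff_apply_one (d s : ℝ) (u X v : Plane) : coneCoeff d s u X v 1 =
    X 0 * v 0 * (s ^ 2 / 2 * u 1 - d ^ 2 * s ^ 2 / 8 * u 1 ^ 2 * u 1) +
    (X 0 * v 1 + X 1 * v 0) *
      (-(s ^ 2 / 2) * u 0 + d ^ 2 * s ^ 2 / 8 * (u 0 * u 1) * u 1 - d * s / 2 * u 1) +
    X 1 * v 1 * (-(s ^ 2 / 2) * u 1 - d ^ 2 * s ^ 2 / 8 * u 0 ^ 2 * u 1 + d * s * u 0) := by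
  simp [coneCoeff, symBilin_apply]

theorem coneChristoffel_symm (d : ℝ) (u X v : Plane) :
    coneChristoffel d u X v = coneChristoffel d u v X := symBilin_symm ..

/-- Smoothness jointly in the parameter and the point, as the smooth dependence of the family on its
parameter requires; away from 0 the norm causes no trouble. -/
theorem contDiffAt_coneChristoffel {q : ℝ × Plane} (hq : q.2 ≠ 0) :
    ContDiffAt ℝ ∞ (fun q : ℝ × Plane ↦ coneChristoffel q.1 q.2) q := by
  have h0 : ContDiffAt ℝ ∞ (fun q : ℝ × Plane ↦ q.2 0) q := by fun_prop
  have h1 : ContDiffAt ℝ ∞ (fun q : ℝ × Plane ↦ q.2 1) q := by fun_prop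
  have hs : ContDiffAt ℝ ∞ (fun q : ℝ × Plane ↦ ‖q.2‖⁻¹) q :=
    (contDiffAt_snd.norm ℝ hq).inv (norm_ne_zero_iff.2 hq)
  have hd : ContDiffAt ℝ ∞ (fun q : ℝ × Plane ↦ q.1) q := contDiffAt_fst
  unfold coneChristoffel coneCoeff
  refine ContDiffAt.symBilin (ContDiffAt.vec2 ?_ ?_) (ContDiffAt.vec2 ?_ ?_)
    (ContDiffAt.vec2 ?_ ?_) <;> fun_prop

theorem contDiffOn_coneChristoffel (d : ℝ) : ContDiffOn ℝ ∞ (coneChristoffel d) {0}ᶜ := by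
  intro u hu
  have h1 : ContDiffAt ℝ ∞ (fun u : Plane ↦ (d, u)) u := by fun_prop
  exact ((contDiffAt_coneChristoffel (q := (d, u)) hu).comp u h1).contDiffWithinAt

theorem inv_norm_sq_mul {u : Plane} (hu : u ≠ 0) : ‖u‖⁻¹ ^ 2 * (u 0 ^ 2 + u 1 ^ 2) = 1 := by
  have h : ‖u‖ ^ 2 = u 0 ^ 2 + u 1 ^ 2 := by
    rw [EuclideanSpace.norm_sq_eq]; simp
  rw [← h, ← mul_pow, inv_mul_cancel₀ (norm_ne_zero_iff.2 hu), one_pow]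

theorem hasDerivAt_inv_norm {u : Plane} (hu : u ≠ 0) (Y : Plane) :
    HasDerivAt (fun t : ℝ ↦ ‖u + t • Y‖⁻¹) (-(‖u‖⁻¹ ^ 3 * (u 0 * Y 0 + u 1 * Y 1))) 0 := by
  have h1 : HasDerivAt (fun t : ℝ ↦ u + t • Y) Y 0 := by
    simpa using ((hasDerivAt_id (0 : ℝ)).smul_const Y).const_add u
  have h2 := h1.norm_sq
  have hr : ‖u‖ ≠ 0 := norm_ne_zero_iff.2 hu
  have h3 : HasDerivAt (fun t : ℝ ↦ √(‖u + t • Y‖ ^ 2)) _ 0 := h2.sqrt (by simpa using hr)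
  simp only [Real.sqrt_sq (norm_nonneg _)] at h3
  have h4 := h3.inv (by simpa using hr)
  refine h4.congr_deriv ?_
  simp [PiLp.inner_apply, Fin.sum_univ_two]
  field_simp

end Plane

/-! ### Curvature of the connections in the squaring chart. -/

section Plane

theorem differentiableAt_coneChristoffel (d : ℝ) {u : Plane} (hu : u ≠ 0) (X v : Plane) :
    DifferentiableAt ℝ (fun w ↦ coneChristoffel d w X v) u := by
  have h : DifferentiableAt ℝ (coneChristoffel d) u :=
    ((contDiffOn_coneChristoffel d).contDiffAt
      (isOpen_compl_singleton.mem_nhds hu)).differentiableAt (by simp)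
  exact (h.clm_apply (differentiableAt_const X)).clm_apply (differentiableAt_const v)

/-- Reduces a component of a total derivative to a one-variable derivative along a line, where the
product rule applies mechanically. -/
theorem fderiv_apply_eq_of_hasDerivAt {F : Plane → Plane} {u Y : Plane}
    (hF : DifferentiableAt ℝ F u) (i : Fin 2) {c : ℝ}
    (h : HasDerivAt (fun t : ℝ ↦ F (u + t • Y) i) c 0) : fderiv ℝ F u Y i = c := by
  have h1 : HasDerivAt (fun t : ℝ ↦ u + t • Y) Y 0 := by
    simpa using ((hasDerivAt_id (0 : ℝ)).smul_const Y).const_add u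
  have h2 : HasFDerivAt F (fderiv ℝ F u) (u + (0 : ℝ) • Y) := by simpa using hF.hasFDerivAt
  have h3 := h2.comp_hasDerivAt 0 h1
  have h4 := (hasDerivAt_pi.1 ((PiLp.hasFDerivAt_ofLp 2 _).comp_hasDerivAt 0 h3)) i
  exact h4.unique h

theorem hasDerivAt_coord (u Y : Plane) (i : Fin 2) :
    HasDerivAt (fun t : ℝ ↦ (u + t • Y) i) (Y i) 0 := by
  simpa using ((hasDerivAt_id (0 : ℝ)).mul_const (Y i)).const_add (u i)

/-- The derivative of the first component of the Christoffel symbol, by the product rule. -/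
theorem fderiv_coneChristoffel_zero (d : ℝ) {u : Plane} (hu : u ≠ 0) (X v Y : Plane) {s σ : ℝ}
    (hs : s = ‖u‖⁻¹) (hσ : σ = -(s ^ 3 * (u 0 * Y 0 + u 1 * Y 1))) :
    fderiv ℝ (fun w ↦ coneChristoffel d w X v) u Y 0 =
      X 0 * v 0 * (-(s * σ) * u 0 - s ^ 2 / 2 * Y 0 - d ^ 2 * s * σ / 4 * u 1 ^ 2 * u 0
        - d ^ 2 * s ^ 2 / 8 * (2 * u 1 * Y 1 * u 0 + u 1 ^ 2 * Y 0) - d * σ * u 1 - d * s * Y 1) +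
      (X 0 * v 1 + X 1 * v 0) *
        (-(s * σ) * u 1 - s ^ 2 / 2 * Y 1 + d ^ 2 * s * σ / 4 * (u 0 * u 1) * u 0
        + d ^ 2 * s ^ 2 / 8 * (2 * u 0 * Y 0 * u 1 + u 0 ^ 2 * Y 1)
        + d * σ / 2 * u 0 + d * s / 2 * Y 0) +
      X 1 * v 1 * (s * σ * u 0 + s ^ 2 / 2 * Y 0 - d ^ 2 * s * σ / 4 * u 0 ^ 2 * u 0
        - d ^ 2 * s ^ 2 / 8 * (3 * u 0 ^ 2 * Y 0)) := by
  subst hs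
  refine fderiv_apply_eq_of_hasDerivAt (differentiableAt_coneChristoffel d hu X v) 0 ?_
  have hS := hasDerivAt_inv_norm hu Y
  rw [← hσ] at hS
  have h0 := hasDerivAt_coord u Y 0
  have h1 := hasDerivAt_coord u Y 1
  unfold coneChristoffel
  simp only [coneCoeff_apply_zero]
  have hS2 := hS.pow 2
  have hA := ((((hS2.div_const 2).neg.mul h0).sub
    ((((hS2.const_mul (d ^ 2)).div_const 8).mul (h1.pow 2)).mul h0)).sub
      ((hS.const_mul d).mul h1)).const_mul (X 0 * v 0)
  have hB := ((((hS2.div_const 2).neg.mul h1).add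
    ((((hS2.const_mul (d ^ 2)).div_const 8).mul (h0.mul h1)).mul h0)).add
      (((hS.const_mul d).div_const 2).mul h0)).const_mul (X 0 * v 1 + X 1 * v 0)
  have hC := (((hS2.div_const 2).mul h0).sub
    ((((hS2.const_mul (d ^ 2)).div_const 8).mul (h0.pow 2)).mul h0)).const_mul (X 1 * v 1)
  refine ((hA.add hB).add hC).congr_deriv ?_
  simp
  ring

theorem fderiv_coneChristoffel_one (d : ℝ) {u : Plane} (hu : u ≠ 0) (X v Y : Plane) {s σ : ℝ}
    (hs : s = ‖u‖⁻¹) (hσ : σ = -(s ^ 3 * (u 0 * Y 0 + u 1 * Y 1))) :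
    fderiv ℝ (fun w ↦ coneChristoffel d w X v) u Y 1 =
      X 0 * v 0 * (s * σ * u 1 + s ^ 2 / 2 * Y 1 - d ^ 2 * s * σ / 4 * u 1 ^ 2 * u 1
        - d ^ 2 * s ^ 2 / 8 * (3 * u 1 ^ 2 * Y 1)) +
      (X 0 * v 1 + X 1 * v 0) *
        (-(s * σ) * u 0 - s ^ 2 / 2 * Y 0 + d ^ 2 * s * σ / 4 * (u 0 * u 1) * u 1
        + d ^ 2 * s ^ 2 / 8 * (2 * u 1 * Y 1 * u 0 + u 1 ^ 2 * Y 0)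
        - d * σ / 2 * u 1 - d * s / 2 * Y 1) +
      X 1 * v 1 * (-(s * σ) * u 1 - s ^ 2 / 2 * Y 1 - d ^ 2 * s * σ / 4 * u 0 ^ 2 * u 1
        - d ^ 2 * s ^ 2 / 8 * (2 * u 0 * Y 0 * u 1 + u 0 ^ 2 * Y 1)
        + d * σ * u 0 + d * s * Y 0) := by
  subst hs
  refine fderiv_apply_eq_of_hasDerivAt (differentiableAt_coneChristoffel d hu X v) 1 ?_
  have hS := hasDerivAt_inv_norm hu Y
  rw [← hσ] at hS
  have h0 := hasDerivAt_coord u Y 0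
  have h1 := hasDerivAt_coord u Y 1
  unfold coneChristoffel
  simp only [coneCoeff_apply_one]
  have hS2 := hS.pow 2
  have hA := (((hS2.div_const 2).mul h1).sub
    ((((hS2.const_mul (d ^ 2)).div_const 8).mul (h1.pow 2)).mul h1)).const_mul (X 0 * v 0)
  have hB := ((((hS2.div_const 2).neg.mul h0).add
    ((((hS2.const_mul (d ^ 2)).div_const 8).mul (h0.mul h1)).mul h1)).sub
      (((hS.const_mul d).div_const 2).mul h1)).const_mul (X 0 * v 1 + X 1 * v 0)
  have hC := ((((hS2.div_const 2).neg.mul h1).sub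
    ((((hS2.const_mul (d ^ 2)).div_const 8).mul (h0.pow 2)).mul h1)).add
      ((hS.const_mul d).mul h0)).const_mul (X 1 * v 1)
  refine ((hA.add hB).add hC).congr_deriv ?_
  simp
  ring

/-- On the spinor plane the curvature is 3d ω(Y, X) Z. Squaring multiplies areas by 4|z|² = 4|u|,
which accounts for the factor 3d / (4|u|). Here it is checked by direct computation in the chart. -/
theorem coneChristoffel_curvature (d : ℝ) {u : Plane} (hu : u ≠ 0) (X Y Z : Plane) :
    christoffelCurvature (coneChristoffel d) u X Y Z =
      (3 * d / 4 * ‖u‖⁻¹ * (Y 0 * X 1 - Y 1 * X 0)) • Z := by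
  have hn := inv_norm_sq_mul hu
  have hC : coneChristoffel d u = coneCoeff d ‖u‖⁻¹ u := rfl
  ext i
  unfold christoffelCurvature
  fin_cases i
  · simp only [Fin.zero_eta, PiLp.sub_apply, PiLp.add_apply, PiLp.smul_apply, smul_eq_mul]
    rw [fderiv_coneChristoffel_zero d hu Z X Y rfl rfl, fderiv_coneChristoffel_zero d hu Z Y X rfl rfl,
      hC]
    simp only [coneCoeff_apply_zero, coneCoeff_apply_one]
    -- With s for 1/|u| both sides are polynomials, equal modulo the single relation s²(u₀² + u₁²) =
    -- 1; the multiplier below is the cofactor of that relation.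
    generalize ‖u‖⁻¹ = s at *
    linear_combination (X 0 * Y 1 - X 1 * Y 0) * (Z 0 * (3 / 4 * s * d + 1 / 4 * u 0 * u 1 * s ^ 2 * d ^ 2)
      + Z 1 * (s ^ 2 - 1 / 4 * u 0 ^ 2 * s ^ 2 * d ^ 2)) * hn
  · simp only [Fin.mk_one, PiLp.sub_apply, PiLp.add_apply, PiLp.smul_apply, smul_eq_mul]
    rw [fderiv_coneChristoffel_one d hu Z X Y rfl rfl, fderiv_coneChristoffel_one d hu Z Y X rfl rfl,
      hC]
    simp only [coneCoeff_apply_zero, coneCoeff_apply_one]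
    generalize ‖u‖⁻¹ = s at *
    linear_combination (X 0 * Y 1 - X 1 * Y 0) * (Z 0 * (-s ^ 2 + 1 / 4 * u 1 ^ 2 * s ^ 2 * d ^ 2)
      + Z 1 * (3 / 4 * s * d - 1 / 4 * u 0 * u 1 * s ^ 2 * d ^ 2)) * hn

end Plane

/-! ### The lift to the spinor plane, and its affine parametrizations by the group. -/

section Plane

/-- The standard area form of the plane. -/
def planeArea (x y : Plane) : ℝ := x 0 * y 1 - x 1 * y 0

/-- The Christoffel symbol of the lift of `∇^d` to the punctured plane:
`Γ(X, v) = - d² / 4 ω(z, X) ω(z, v) z + d (ω(z, X) v + ω(z, v) X)`. -/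
def planeChristoffel (d : ℝ) (z : Plane) : Plane →L[ℝ] Plane →L[ℝ] Plane :=
  symBilin (-(d ^ 2 / 4 * z 1 ^ 2) • z + !₂[-(2 * d * z 1), 0])
    ((d ^ 2 / 4 * (z 0 * z 1)) • z + !₂[d * z 0, -(d * z 1)])
    (-(d ^ 2 / 4 * z 0 ^ 2) • z + !₂[0, 2 * d * z 0])

theorem planeChristoffel_apply (d : ℝ) (z X v : Plane) : planeChristoffel d z X v =
    -(d ^ 2 / 4 * (planeArea z X * planeArea z v)) • z +
      d • (planeArea z X • v + planeArea z v • X) := by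
  ext i
  fin_cases i
  · simp [planeChristoffel, symBilin_apply, planeArea]
    ring
  · simp [planeChristoffel, symBilin_apply, planeArea]
    ring

/-- A linear map has no second derivative, and the Christoffel symbol is built from the position
vector and the area form only. -/
theorem isAffineAt_planeChristoffel (d : ℝ) (g : Plane →L[ℝ] Plane)
    (hg : ∀ x y, planeArea (g x) (g y) = planeArea x y) (z : Plane) :
    IsAffineAt (planeChristoffel d) (planeChristoffel d) g z := by
  intro X v
  have h : fderiv ℝ (g : Plane → Plane) = fun _ ↦ g := funext fun _ ↦ g.fderiv
  rw [h]
  simp [planeChristoffel_apply, hg]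

/-- The polarized squaring map of the plane (multiplication of complex numbers, doubled). -/
def squarePolar : Plane →L[ℝ] Plane →L[ℝ] Plane := symBilin !₂[2, 0] !₂[0, 2] !₂[-2, 0]

theorem squarePolar_apply_zero (X v : Plane) : squarePolar X v 0 = 2 * (X 0 * v 0 - X 1 * v 1) := by
  simp [squarePolar, symBilin_apply]
  ring

theorem squarePolar_apply_one (X v : Plane) : squarePolar X v 1 = 2 * (X 0 * v 1 + X 1 * v 0) := by
  simp [squarePolar, symBilin_apply]
  ring

/-- The squaring map of the plane `z ↦ z²` (in complex notation). -/
def planeSquare (z : Plane) : Plane := !₂[z 0 ^ 2 - z 1 ^ 2, 2 * (z 0 * z 1)]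

@[simp] theorem planeSquare_apply_zero (z : Plane) : planeSquare z 0 = z 0 ^ 2 - z 1 ^ 2 := by
  simp [planeSquare]

@[simp] theorem planeSquare_apply_one (z : Plane) : planeSquare z 1 = 2 * (z 0 * z 1) := by
  simp [planeSquare]

theorem planeSquare_eq (z : Plane) : planeSquare z = (1 / 2 : ℝ) • squarePolar z z := by
  ext i
  fin_cases i
  · simp [squarePolar_apply_zero]; ring
  · simp [squarePolar_apply_one]; ring

theorem fderiv_planeSquare : fderiv ℝ planeSquare = squarePolar := by
  funext z
  have h : HasFDerivAt (fun z ↦ squarePolar z z) _ z :=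
    (squarePolar.hasFDerivAt (x := z)).clm_apply (hasFDerivAt_id z)
  have h2 : planeSquare = fun z ↦ (1 / 2 : ℝ) • squarePolar z z := funext planeSquare_eq
  rw [h2]
  refine Eq.trans (h.const_smul (1 / 2 : ℝ)).fderiv ?_
  ext v i
  fin_cases i
  · simp [squarePolar_apply_zero]; ring
  · simp [squarePolar_apply_one]; ring

theorem contDiff_planeSquare : ContDiff ℝ ∞ planeSquare := by
  have h2 : planeSquare = fun z ↦ (1 / 2 : ℝ) • squarePolar z z := funext planeSquare_eq
  rw [h2]
  fun_prop

theorem norm_planeSquare (z : Plane) : ‖planeSquare z‖ = z 0 ^ 2 + z 1 ^ 2 := by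
  have h : ‖planeSquare z‖ ^ 2 = (z 0 ^ 2 + z 1 ^ 2) ^ 2 := by
    rw [EuclideanSpace.norm_sq_eq]; simp; ring
  exact (pow_left_inj₀ (norm_nonneg _) (by positivity) two_ne_zero).1 h

theorem sq_add_sq_pos_of_ne_zero {z : Plane} (hz : z ≠ 0) : 0 < z 0 ^ 2 + z 1 ^ 2 := by
  by_contra h
  refine hz ?_
  ext i
  fin_cases i <;> simp <;> nlinarith [sq_nonneg (z 0), sq_nonneg (z 1)]

theorem planeSquare_ne_zero {z : Plane} (hz : z ≠ 0) : planeSquare z ≠ 0 := by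
  rw [← norm_ne_zero_iff, norm_planeSquare]
  exact (sq_add_sq_pos_of_ne_zero hz).ne'

theorem surjective_fderiv_planeSquare {z : Plane} (hz : z ≠ 0) :
    Function.Surjective (fderiv ℝ planeSquare z) := by
  intro w
  have hn := (sq_add_sq_pos_of_ne_zero hz).ne'
  refine ⟨!₂[(z 0 * w 0 + z 1 * w 1) / (2 * (z 0 ^ 2 + z 1 ^ 2)),
    (z 0 * w 1 - z 1 * w 0) / (2 * (z 0 ^ 2 + z 1 ^ 2))], ?_⟩
  rw [fderiv_planeSquare]
  ext i
  fin_cases i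
  · simp [squarePolar_apply_zero]; field_simp; ring
  · simp [squarePolar_apply_one]; field_simp; ring

/-- This is where `coneCoeff` comes from. In complex notation, U = 2zX and V = 2zv give D²(z²)(v, X)
= UV/(2u) and ω(z, X) = ω(u, U)/(2|u|), so the pushed-down symbol is -UV/(2u) - d²/(8|u|²) ω(u, U)
ω(u, V) u + d/(2|u|) (ω(u, U) V + ω(u, V) U). Here 1/u is written as the conjugate of u over |u|².
-/
theorem isAffineAt_planeSquare (d : ℝ) {z : Plane} (hz : z ≠ 0) :
    IsAffineAt (planeChristoffel d) (coneChristoffel d) planeSquare z := by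
  intro X v
  have hn := (sq_add_sq_pos_of_ne_zero hz).ne'
  have h2 : fderiv ℝ (fderiv ℝ planeSquare) z v = squarePolar v := by
    rw [fderiv_planeSquare, squarePolar.fderiv]
  rw [h2, fderiv_planeSquare, coneChristoffel, norm_planeSquare, planeChristoffel_apply]
  ext i
  fin_cases i
  · simp only [Fin.zero_eta, squarePolar_apply_zero, squarePolar_apply_one, PiLp.add_apply,
      coneCoeff_apply_zero, planeSquare_apply_zero, planeSquare_apply_one, PiLp.smul_apply,
      smul_eq_mul, planeArea]
    field_simp
    ring
  · simp only [Fin.mk_one, squarePolar_apply_zero, squarePolar_apply_one, PiLp.add_apply,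
      coneCoeff_apply_one, planeSquare_apply_zero, planeSquare_apply_one, PiLp.smul_apply,
      smul_eq_mul, planeArea]
    field_simp
    ring

/-- The Christoffel symbol of `∇(1, 0)` in the coordinates `(s, t)`. -/
def modelChristoffel (p : ℝ × ℝ) : (ℝ × ℝ) →L[ℝ] (ℝ × ℝ) →L[ℝ] (ℝ × ℝ) :=
  (ContinuousLinearMap.fst ℝ ℝ ℝ).smulRight
      ((ContinuousLinearMap.fst ℝ ℝ ℝ).smulRight
          (4 * Real.exp (2 * p.2), -Real.exp (2 * p.2) ^ 2) +
        (ContinuousLinearMap.snd ℝ ℝ ℝ).smulRight (1, 2 * Real.exp (2 * p.2))) +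
    (ContinuousLinearMap.snd ℝ ℝ ℝ).smulRight
      ((ContinuousLinearMap.fst ℝ ℝ ℝ).smulRight (1, 2 * Real.exp (2 * p.2)) +
        (ContinuousLinearMap.snd ℝ ℝ ℝ).smulRight (0, 1))

theorem modelChristoffel_apply (p X v : ℝ × ℝ) : modelChristoffel p X v =
    (4 * Real.exp (2 * p.2) * (X.1 * v.1) + (X.1 * v.2 + X.2 * v.1),
      -Real.exp (2 * p.2) ^ 2 * (X.1 * v.1) + 2 * Real.exp (2 * p.2) * (X.1 * v.2 + X.2 * v.1)
        + X.2 * v.2) := by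
  ext
  · simp [modelChristoffel]; ring
  · simp [modelChristoffel]; ring

/-- Change of frame from u, w to ∂_s = exp(2t) u, ∂_t = w. The derivative of the factor exp(2t) in
the u-component contributes to the mixed Christoffel terms. Differentiability of the field is needed
to apply the product rule. -/
theorem modelConnection_apply_eq {X : ℝ × ℝ → ℝ × ℝ} {p : ℝ × ℝ} (hX : DifferentiableAt ℝ X p)
    (v : ℝ × ℝ) :
    modelValue 1 0 (fderiv ℝ (modelCoeffU X) p) (fderiv ℝ (modelCoeffW X) p)
      (modelCoeffU X p) (modelCoeffW X p) p v = fderiv ℝ X p v + modelChristoffel p (X p) v := by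
  have h1 : HasFDerivAt (fun q : ℝ × ℝ ↦ (X q).1) ((ContinuousLinearMap.fst ℝ ℝ ℝ).comp
      (fderiv ℝ X p)) p := hasFDerivAt_fst.comp p hX.hasFDerivAt
  have h2 : HasFDerivAt (fun q : ℝ × ℝ ↦ (X q).2) ((ContinuousLinearMap.snd ℝ ℝ ℝ).comp
      (fderiv ℝ X p)) p := hasFDerivAt_snd.comp p hX.hasFDerivAt
  have he : HasFDerivAt (fun z : ℝ × ℝ ↦ Real.exp (2 * z.2))
      (Real.exp (2 * p.2) • ((2 : ℝ) • ContinuousLinearMap.snd ℝ ℝ ℝ)) p :=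
    ((ContinuousLinearMap.snd ℝ ℝ ℝ).hasFDerivAt.const_mul (2 : ℝ)).exp
  have hU : fderiv ℝ (modelCoeffU X) p = _ := (he.mul h1).fderiv
  have hW : fderiv ℝ (modelCoeffW X) p = _ := h2.fderiv
  have hm : Real.exp (2 * p.2) * Real.exp (-(2 * p.2)) = 1 := by
    rw [← Real.exp_add]; simp
  rw [hU, hW, modelValue_apply, modelChristoffel_apply]
  simp only [modelNablaU, modelNablaW, modelMap, modelU, modelW, modelCoeffU, modelCoeffW]
  ext
  · simp
    linear_combination ((fderiv ℝ X p v).1 + (X p).1 * v.2 + v.1 * (X p).2 +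
      4 * Real.exp (2 * p.2) * (X p).1 * v.1) * hm
  · simp
    ring

theorem hasChristoffel_modelConnection :
    HasChristoffel (modelConnection 1 0) (OpenPartialHomeomorph.refl (ℝ × ℝ)) modelChristoffel :=
  fun X _ hX v ↦ modelConnection_apply_eq (X := coordField (OpenPartialHomeomorph.refl _) X) hX v

/-- The parametrization of a half-plane by the group, affine from `∇(1, 0)` to `∇^d` for
`k = 2 / d`. -/
def modelParam (k s₀ : ℝ) (e f : Plane) (p : ℝ × ℝ) : Plane :=
  Real.exp p.2 • ((k * (p.1 - s₀)) • e + f)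

theorem hasFDerivAt_modelParam (k s₀ : ℝ) (e f : Plane) (p : ℝ × ℝ) :
    HasFDerivAt (modelParam k s₀ e f)
      ((k * Real.exp p.2) • (ContinuousLinearMap.fst ℝ ℝ ℝ).smulRight e +
        (ContinuousLinearMap.snd ℝ ℝ ℝ).smulRight (modelParam k s₀ e f p)) p := by
  have he : HasFDerivAt (fun z : ℝ × ℝ ↦ Real.exp z.2)
      (Real.exp p.2 • ContinuousLinearMap.snd ℝ ℝ ℝ) p :=
    (ContinuousLinearMap.snd ℝ ℝ ℝ).hasFDerivAt.exp
  have h1 : HasFDerivAt (fun z : ℝ × ℝ ↦ (k * (z.1 - s₀)) • e + f)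
      ((k • ContinuousLinearMap.fst ℝ ℝ ℝ).smulRight e) p :=
    (((hasFDerivAt_fst.sub_const s₀).const_mul k).smul_const e).add_const f
  refine (he.smul h1).congr_fderiv ?_
  ext v <;> simp [modelParam] <;> ring

theorem contDiff_modelParam (k s₀ : ℝ) (e f : Plane) : ContDiff ℝ ∞ (modelParam k s₀ e f) := by
  unfold modelParam
  fun_prop

theorem fderiv_fderiv_modelParam (k s₀ : ℝ) (e f : Plane) (p v X : ℝ × ℝ) :
    fderiv ℝ (fderiv ℝ (modelParam k s₀ e f)) p v X =
      (k * Real.exp p.2 * (X.1 * v.2 + X.2 * v.1)) • e +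
        (X.2 * v.2) • modelParam k s₀ e f p := by
  have h : fderiv ℝ (modelParam k s₀ e f) = fun p ↦
      (k * Real.exp p.2) • (ContinuousLinearMap.fst ℝ ℝ ℝ).smulRight e +
        (ContinuousLinearMap.smulRightL ℝ (ℝ × ℝ) Plane (ContinuousLinearMap.snd ℝ ℝ ℝ))
          (modelParam k s₀ e f p) :=
    funext fun p ↦ (hasFDerivAt_modelParam k s₀ e f p).fderiv
  have he : HasFDerivAt (fun z : ℝ × ℝ ↦ k * Real.exp z.2)
      (k • (Real.exp p.2 • ContinuousLinearMap.snd ℝ ℝ ℝ)) p :=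
    ((ContinuousLinearMap.snd ℝ ℝ ℝ).hasFDerivAt.exp).const_mul k
  have h2 := (he.smul_const ((ContinuousLinearMap.fst ℝ ℝ ℝ).smulRight e)).add
    ((ContinuousLinearMap.smulRightL ℝ (ℝ × ℝ) Plane
      (ContinuousLinearMap.snd ℝ ℝ ℝ)).hasFDerivAt.comp p (hasFDerivAt_modelParam k s₀ e f p))
  rw [h]
  refine (congrArg (fun L : (ℝ × ℝ) →L[ℝ] (ℝ × ℝ) →L[ℝ] Plane ↦ L v X) h2.fderiv).trans ?_
  simp
  module

/-- Write H for the map and k = 2/d. Then H_t = H, ω(H, H_t) = 0 and ω(H, H_s) = k exp(2t). The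
value of k is forced by matching with `modelChristoffel`: the s-s entry needs 2dk = 4 and d²k²/4 =
1, the mixed entry needs dk = 2. -/
theorem isAffineAt_modelParam {d : ℝ} (hd : d ≠ 0) (s₀ : ℝ) {e f : Plane}
    (hef : planeArea f e = 1) (p : ℝ × ℝ) :
    IsAffineAt modelChristoffel (planeChristoffel d) (modelParam (2 / d) s₀ e f) p := by
  intro X v
  have hexp : Real.exp (2 * p.2) = Real.exp p.2 ^ 2 := by
    rw [← Real.exp_nat_mul]; norm_num
  have hHe : planeArea (modelParam (2 / d) s₀ e f p) e = Real.exp p.2 := by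
    have : planeArea (modelParam (2 / d) s₀ e f p) e = Real.exp p.2 * planeArea f e := by
      simp [planeArea, modelParam]; ring
    rw [this, hef, mul_one]
  have hA : ∀ w : ℝ × ℝ, planeArea (modelParam (2 / d) s₀ e f p)
      (fderiv ℝ (modelParam (2 / d) s₀ e f) p w) = 2 / d * Real.exp p.2 ^ 2 * w.1 := by
    intro w
    have : ∀ (x y : Plane) (a b : ℝ), planeArea x (a • y + b • x) = a * planeArea x y := by
      intro x y a b; simp [planeArea]; ring
    rw [(hasFDerivAt_modelParam ..).fderiv]
    simp only [add_apply, smul_apply,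
      ContinuousLinearMap.smulRight_apply, ContinuousLinearMap.coe_fst',
      ContinuousLinearMap.coe_snd', smul_smul]
    rw [this, hHe]; ring
  rw [fderiv_fderiv_modelParam, planeChristoffel_apply, hA, hA]
  rw [(hasFDerivAt_modelParam ..).fderiv, modelChristoffel_apply, hexp]
  generalize modelParam (2 / d) s₀ e f p = H
  ext i
  simp
  field_simp
  ring

end Plane

/-! ## Lorentzian coordinates on the space of traceless endomorphisms -/

section Lorentz

/-- On S the set where F > 0 is also the set where F ≥ 0, hence clopen, and it contains 1. This is
how discrete invariants (time direction, orientation) are seen to be constant on the identity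
component. -/
theorem pos_of_mem_identityComponent {W : Type*} [NormedAddCommGroup W] [NormedSpace ℝ W]
    {S : Subgroup (W →L[ℝ] W)ˣ} {F : (W →L[ℝ] W) → ℝ} (hF : Continuous F)
    (h0 : ∀ T ∈ S, F T.1 ≠ 0) (h1 : 0 < F 1) {T : (W →L[ℝ] W)ˣ} (hT : T ∈ identityComponent S) :
    0 < F T.1 := by
  obtain ⟨t, ht, rfl⟩ := hT
  have hc : Continuous fun t : S ↦ F t.1.1 :=
    hF.comp (Units.continuous_val.comp continuous_subtype_val)
  have hclopen : IsClopen {t : S | 0 < F t.1.1} := by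
    refine ⟨?_, isOpen_lt continuous_const hc⟩
    have : {t : S | 0 < F t.1.1} = {t : S | 0 ≤ F t.1.1} :=
      Set.ext fun t ↦ ⟨fun h ↦ (show 0 < F t.1.1 from h).le,
        fun h ↦ lt_of_le_of_ne h (h0 t.1 t.2).symm⟩
    rw [this]
    exact isClosed_le continuous_const hc
  exact hclopen.connectedComponent_subset (x := (1 : S)) h1 ht

/-- A one-parameter group of elements of `S` lies in the identity component. -/
theorem exists_mem_identityComponent {W : Type*} [NormedAddCommGroup W] [NormedSpace ℝ W]
    {S : Subgroup (W →L[ℝ] W)ˣ} {ρ : ℝ → W →L[ℝ] W} (hρ : Continuous ρ)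
    (hρ0 : ρ 0 = 1) (hinv : ∀ t, ρ t * ρ (-t) = 1)
    (hS : ∀ T : (W →L[ℝ] W)ˣ, (∃ t, T.1 = ρ t) → T ∈ S) (t : ℝ) :
    ∃ T ∈ identityComponent S, T.1 = ρ t := by
  let U : ℝ → (W →L[ℝ] W)ˣ := fun t ↦
    ⟨ρ t, ρ (-t), hinv t, by simpa using hinv (-t)⟩
  have hU : Continuous U :=
    Units.continuous_iff.2 ⟨hρ, hρ.comp continuous_neg⟩
  let U' : ℝ → S := fun t ↦ ⟨U t, hS _ ⟨t, rfl⟩⟩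
  have hU' : Continuous U' := hU.subtype_mk _
  have h0 : U' 0 = 1 := Subtype.ext (Units.ext hρ0)
  refine ⟨U t, ⟨U' t, ?_, rfl⟩, rfl⟩
  have := (isPreconnected_range hU').subset_connectedComponent (x := U' 0) ⟨0, rfl⟩ ⟨t, rfl⟩
  rwa [h0] at this

variable {P : Type*} [NormedAddCommGroup P] [NormedSpace ℝ P]

/-- A linear coordinate system on the space of traceless endomorphisms in which the Lorentzian
form is `(‖u‖² - τ²) / 4` and the future null cone is `τ = ‖u‖ > 0`. -/
structure IsLorentzCoord (Ω : LinearMap.BilinForm ℝ P) (L : TracelessEnd P ≃L[ℝ] Plane × ℝ) :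
    Prop where
  lorentzForm_eq : ∀ A, lorentzForm P A = (‖(L A).1‖ ^ 2 - (L A).2 ^ 2) / 4
  mem_iff : ∀ A, A ∈ futureNullCone Ω ↔ 0 < (L A).2 ∧ ‖(L A).1‖ = (L A).2

/-- The null vector with spinor `z`. -/
def nullVector (z : Plane) : Plane × ℝ := (planeSquare z, z 0 ^ 2 + z 1 ^ 2)

theorem exists_planeSquare_eq (u : Plane) : ∃ z, planeSquare z = u := by
  obtain ⟨w, hw⟩ := IsAlgClosed.exists_pow_nat_eq (⟨u 0, u 1⟩ : ℂ) (n := 2) two_pos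
  refine ⟨!₂[w.re, w.im], ?_⟩
  have h0 := congrArg Complex.re hw
  have h1 := congrArg Complex.im hw
  simp [pow_two] at h0 h1
  ext i
  fin_cases i
  · simp; linarith
  · simp; linarith

theorem exists_nullVector_eq {w : Plane × ℝ} (h : 0 < w.2) (hw : ‖w.1‖ = w.2) :
    ∃ z, z ≠ 0 ∧ nullVector z = w := by
  obtain ⟨z, hz⟩ := exists_planeSquare_eq w.1
  have h2 : z 0 ^ 2 + z 1 ^ 2 = w.2 := by rw [← norm_planeSquare, hz, hw]
  refine ⟨z, ?_, Prod.ext hz h2⟩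
  rintro rfl
  simp at h2
  exact h.ne h2

theorem norm_fst_nullVector (z : Plane) : ‖(nullVector z).1‖ = (nullVector z).2 :=
  norm_planeSquare z

theorem snd_nullVector_pos {z : Plane} (hz : z ≠ 0) : 0 < (nullVector z).2 :=
  sq_add_sq_pos_of_ne_zero hz

/-- In a basis with Ω(e₀, e₁) = 1 and z = p e₀ + q e₁, the endomorphism Φ(z) has matrix rows (-pq,
p²) and (-q², pq). The coordinates (m₀₁ + m₁₀, 2 m₁₁, m₀₁ - m₁₀) of a traceless matrix therefore
take it to (p² - q², 2pq, p² + q²), the null vector with spinor (p, q), and turn -det into (|u|² -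
τ²)/4. -/
theorem exists_isLorentzCoord (hP : Module.finrank ℝ P = 2)
    (Ω : LinearMap.BilinForm ℝ P) (hΩ : Ω.IsAlt) (hΩ0 : Ω ≠ 0) :
    ∃ L : TracelessEnd P ≃L[ℝ] Plane × ℝ, IsLorentzCoord Ω L := by
  have hfin : FiniteDimensional ℝ P := .of_finrank_pos (by omega)
  have hfin' : FiniteDimensional ℝ (TracelessEnd P) := inferInstance
  obtain ⟨x, y, hxy⟩ : ∃ x y, Ω x y ≠ 0 := by
    by_contra! h
    exact hΩ0 (LinearMap.ext fun x ↦ LinearMap.ext fun y ↦ h x y)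
  set e : Fin 2 → P := ![(Ω x y)⁻¹ • x, y] with he
  have hself : ∀ z, Ω z z = 0 := hΩ
  have h01 : Ω (e 0) (e 1) = 1 := by simp [he, hxy]
  have h10 : Ω (e 1) (e 0) = -1 := by rw [← h01, ← hΩ.neg_eq]
  have hli : LinearIndependent ℝ e := by
    rw [Fintype.linearIndependent_iff]
    intro g hg
    rw [Fin.sum_univ_two] at hg
    have h0 := congrArg (fun z ↦ Ω z (e 1)) hg
    have h1 := congrArg (fun z ↦ Ω z (e 0)) hg
    simp [h01, h10, hself] at h0 h1
    intro i
    fin_cases i <;> assumption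
  let b := basisOfLinearIndependentOfCardEqFinrank hli (by simp [hP])
  have hb : ∀ i, b i = e i := fun i ↦ by simp [b]
  let m : (P →L[ℝ] P) →ₗ[ℝ] Matrix (Fin 2) (Fin 2) ℝ :=
    (LinearMap.toMatrix b b).toLinearMap.comp (ContinuousLinearMap.coeLM ℝ)
  have hm : ∀ A i j, m A i j = b.repr (A (e j)) i := fun A i j ↦ by
    simp [m, LinearMap.toMatrix_apply, hb]
  have htr : ∀ A : TracelessEnd P, m A.1 0 0 + m A.1 1 1 = 0 := fun A ↦ by
    have : LinearMap.trace ℝ P (A.1 : P →ₗ[ℝ] P) = 0 := LinearMap.mem_ker.1 A.2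
    rw [LinearMap.trace_eq_matrix_trace ℝ b, Matrix.trace_fin_two] at this
    exact this
  have hdet : ∀ A : TracelessEnd P, lorentzForm P A =
      -(m A.1 0 0 * m A.1 1 1 - m A.1 0 1 * m A.1 1 0) := fun A ↦ by
    rw [lorentzForm, ← LinearMap.det_toMatrix b, Matrix.det_fin_two]
    rfl
  have hinj : Function.Injective m := fun A B h ↦
    ContinuousLinearMap.coe_injective ((LinearMap.toMatrix b b).injective h)
  have hsurj : ∀ M : Matrix (Fin 2) (Fin 2) ℝ, ∃ A, m A = M := fun M ↦
    ⟨LinearMap.toContinuousLinearMap (Matrix.toLin b b M), by simp [m]⟩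
  let F : TracelessEnd P →ₗ[ℝ] Plane × ℝ :=
    { toFun := fun A ↦ (!₂[m A.1 0 1 + m A.1 1 0, 2 * m A.1 1 1], m A.1 0 1 - m A.1 1 0)
      map_add' := by
        intro A B
        ext i
        · fin_cases i
          · simp; ring
          · simp; ring
        · simp; ring
      map_smul' := by
        intro r A
        ext i
        · fin_cases i
          · simp; ring
          · simp; ring
        · simp; ring }
  have hF : ∀ A, F A = (!₂[m A.1 0 1 + m A.1 1 0, 2 * m A.1 1 1], m A.1 0 1 - m A.1 1 0) :=
    fun A ↦ rfl
  have hext : ∀ (A : TracelessEnd P) (w : Plane × ℝ), F A = w ↔ m A.1 0 1 + m A.1 1 0 = w.1 0 ∧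
      2 * m A.1 1 1 = w.1 1 ∧ m A.1 0 1 - m A.1 1 0 = w.2 := by
    intro A w
    rw [hF]
    constructor
    · rintro rfl
      simp
    · rintro ⟨h0, h1, h2⟩
      refine Prod.ext ?_ h2
      ext i
      fin_cases i <;> simpa
  have hFbij : Function.Bijective F := by
    constructor
    · intro A B h
      obtain ⟨h0, h1, h2⟩ := (hext A _).1 h
      simp only [hF, PiLp.toLp_apply, Matrix.cons_val_zero, Matrix.cons_val_one] at h0 h1 h2
      have hA := htr A
      have hB := htr B
      refine Subtype.ext (hinj ?_)
      ext i j
      fin_cases i <;> fin_cases j <;> simp <;> linarith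
    · intro w
      obtain ⟨A, hA⟩ := hsurj !![-(w.1 1 / 2), (w.1 0 + w.2) / 2; (w.1 0 - w.2) / 2, w.1 1 / 2]
      have hA' : A ∈ TracelessEnd P := by
        rw [TracelessEnd, LinearMap.mem_ker, LinearMap.comp_apply,
          LinearMap.trace_eq_matrix_trace ℝ b, Matrix.trace_fin_two]
        change m A 0 0 + m A 1 1 = 0
        rw [hA]
        simp
      refine ⟨⟨A, hA'⟩, (hext _ _).2 ?_⟩
      simp only [hA]
      refine ⟨?_, ?_, ?_⟩ <;> simp <;> ring
  have hexp : ∀ z : P, z = Ω z (e 1) • e 0 + Ω (e 0) z • e 1 := by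
    intro z
    have hz := b.sum_repr z
    rw [Fin.sum_univ_two, hb, hb] at hz
    rw [← hz]
    simp [h01, hself]
  have hrepr : ∀ (r s : ℝ), b.repr (r • e 0 + s • e 1) 0 = r ∧ b.repr (r • e 0 + s • e 1) 1 = s := by
    intro r s
    rw [← hb, ← hb]
    simp
  have hΦ : ∀ (A : TracelessEnd P) (z : P), (∀ v, A.1 v = Ω z v • z) ↔
      F A = nullVector !₂[Ω z (e 1), Ω (e 0) z] := by
    intro A z
    have hz1 : ∀ r : ℝ, b.repr (r • z) 0 = r * Ω z (e 1) ∧ b.repr (r • z) 1 = r * Ω (e 0) z := by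
      intro r
      have := hrepr (Ω z (e 1)) (Ω (e 0) z)
      rw [← hexp z] at this
      simp [this]
    have hz0 : Ω z (e 0) = -Ω (e 0) z := (hΩ.neg_eq _ _).symm
    have ht := htr A
    constructor
    · intro h
      have h00 : m A.1 0 1 = _ := (hm A.1 0 1).trans (by rw [h, (hz1 _).1])
      have h10 : m A.1 1 0 = _ := (hm A.1 1 0).trans (by rw [h, (hz1 _).2, hz0])
      have h11 : m A.1 1 1 = _ := (hm A.1 1 1).trans (by rw [h, (hz1 _).2])
      rw [hext, h00, h10, h11]
      simp [nullVector]
      constructor <;> ring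
    · intro h
      rw [hext] at h
      simp [nullVector] at h
      obtain ⟨h0, h1, h2⟩ := h
      have key : ∀ j, A.1 (e j) = Ω z (e j) • z := by
        intro j
        refine b.repr.injective ?_
        ext i
        rw [← hm]
        fin_cases j <;> fin_cases i
        · simp only [Fin.zero_eta, (hz1 _).1, hz0]; linarith
        · simp only [Fin.zero_eta, Fin.mk_one, (hz1 _).2, hz0]; linarith
        · simp only [Fin.zero_eta, Fin.mk_one, (hz1 _).1]; linarith
        · simp only [Fin.mk_one, (hz1 _).2]; linarith
      intro v
      rw [hexp v, map_add, map_smul, map_smul, key, key]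
      simp [add_smul, smul_smul]
  let L := (LinearEquiv.ofBijective F hFbij).toContinuousLinearEquiv
  have hL : ∀ A, L A = F A := fun A ↦ rfl
  refine ⟨L, fun A ↦ ?_, fun A ↦ ?_⟩
  · have := htr A
    rw [hL, hF, hdet, EuclideanSpace.norm_sq_eq]
    simp
    rw [eq_neg_of_add_eq_zero_left this]
    ring
  · rw [hL]
    constructor
    · rintro ⟨z, hz0, hz⟩
      rw [(hΦ A z).1 hz, norm_fst_nullVector, and_iff_left rfl]
      refine snd_nullVector_pos fun h ↦ hz0 ?_
      have h0 := congrArg (fun y : Plane ↦ y 0) h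
      have h1 := congrArg (fun y : Plane ↦ y 1) h
      simp at h0 h1
      rw [hexp z, h0, h1]
      simp
    · rintro ⟨h1, h2⟩
      obtain ⟨z, hz, hz'⟩ := exists_nullVector_eq h1 h2
      have hc : (!₂[Ω (z 0 • e 0 + z 1 • e 1) (e 1), Ω (e 0) (z 0 • e 0 + z 1 • e 1)] : Plane) = z := by
        ext i
        fin_cases i <;> simp [h01, hself]
      refine ⟨z 0 • e 0 + z 1 • e 1, fun h ↦ hz ?_, (hΦ A _).2 ?_⟩
      · rw [← hc, h]
        ext i
        fin_cases i <;> simp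
      · rw [hc, hz']

end Lorentz

/-! ## The action of the identity component on null vectors -/

section NullVectors

/-- The Minkowski inner product on `Plane × ℝ`. -/
def minkowski (v w : Plane × ℝ) : ℝ := v.1 0 * w.1 0 + v.1 1 * w.1 1 - v.2 * w.2

/-- The determinant of three vectors of `Plane × ℝ`. -/
def triple (a b c : Plane × ℝ) : ℝ :=
  a.1 0 * (b.1 1 * c.2 - b.2 * c.1 1) - a.1 1 * (b.1 0 * c.2 - b.2 * c.1 0) +
    a.2 * (b.1 0 * c.1 1 - b.1 1 * c.1 0)

theorem continuous_triple : Continuous fun p : (Plane × ℝ) × (Plane × ℝ) × (Plane × ℝ) ↦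
    triple p.1 p.2.1 p.2.2 := by
  unfold triple
  fun_prop

theorem minkowski_self (w : Plane × ℝ) : minkowski w w = ‖w.1‖ ^ 2 - w.2 ^ 2 := by
  rw [EuclideanSpace.norm_sq_eq]
  simp [minkowski]
  ring

theorem minkowski_eq (v w : Plane × ℝ) :
    minkowski v w = (minkowski (v + w) (v + w) - minkowski v v - minkowski w w) / 2 := by
  simp [minkowski]
  ring

/-- Gram determinant identity; the sign is the determinant of the Minkowski metric. It makes the
square of a triple determinant a Lorentz invariant. -/
theorem triple_sq (a b c : Plane × ℝ) : triple a b c ^ 2 =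
    -(minkowski a a * minkowski b b * minkowski c c +
      2 * (minkowski a b * minkowski b c * minkowski a c) - minkowski a a * minkowski b c ^ 2 -
      minkowski b b * minkowski a c ^ 2 - minkowski c c * minkowski a b ^ 2) := by
  simp only [triple, minkowski]
  ring

theorem minkowski_nullVector (x y : Plane) :
    minkowski (nullVector x) (nullVector y) = -2 * planeArea x y ^ 2 := by
  simp [minkowski, nullVector, planeArea]
  ring

theorem triple_nullVector (x y z : Plane) :
    triple (nullVector x) (nullVector y) (nullVector z) =
      4 * (planeArea x y * planeArea y z * planeArea x z) := by
  simp [triple, nullVector, planeArea]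
  ring

theorem nullVector_smul (r : ℝ) (x : Plane) : nullVector (r • x) = r ^ 2 • nullVector x := by
  ext i
  · fin_cases i <;> simp [nullVector] <;> ring
  · simp [nullVector]; ring

/-- Polarization: a quadratic map on a plane is determined by its values at x, y and x + y. -/
theorem nullVector_smul_add_smul (r s : ℝ) (x y : Plane) : nullVector (r • x + s • y) =
    r ^ 2 • nullVector x + s ^ 2 • nullVector y +
      (r * s) • (nullVector (x + y) - nullVector x - nullVector y) := by
  ext i
  · fin_cases i <;> simp [nullVector] <;> ring
  · simp [nullVector]; ring

/-- Cramer's rule, the linear relation between three vectors of a plane. -/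
theorem planeArea_smul_eq (x y z : Plane) :
    planeArea x y • z = planeArea z y • x + planeArea x z • y := by
  ext i
  fin_cases i <;> simp [planeArea] <;> ring

/-- A linear isometry of Minkowski space which preserves the future null cone and the orientation is
induced by an area-preserving transformation of spinors. -/
theorem exists_nullVector_lift {S : Plane × ℝ →L[ℝ] Plane × ℝ}
    (hq : ∀ w, minkowski (S w) (S w) = minkowski w w)
    (hτ : ∀ z, z ≠ 0 → 0 < (S (nullVector z)).2)
    (hv : triple (S (nullVector !₂[1, 0])) (S (nullVector !₂[0, 1])) (S (nullVector !₂[1, 1])) < 0) :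
    ∃ g : Plane →L[ℝ] Plane, (∀ x y, planeArea (g x) (g y) = planeArea x y) ∧
      ∀ z, S (nullVector z) = nullVector (g z) := by
  have hB : ∀ v w, minkowski (S v) (S w) = minkowski v w := fun v w ↦ by
    rw [minkowski_eq, minkowski_eq v, ← map_add, hq, hq, hq]
  have hex : ∀ z, z ≠ 0 → ∃ f, nullVector f = S (nullVector z) := fun z hz ↦ by
    obtain ⟨f, -, hf⟩ := exists_nullVector_eq (hτ z hz) (by
      have h := hq (nullVector z)
      rw [minkowski_self, minkowski_self, norm_fst_nullVector, sub_self, sub_eq_zero] at h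
      exact (pow_left_inj₀ (norm_nonneg _) (hτ z hz).le two_ne_zero).1 h)
    exact ⟨f, hf⟩
  have hne : ∀ a b : ℝ, a ≠ 0 ∨ b ≠ 0 → (!₂[a, b] : Plane) ≠ 0 := fun a b h h0 ↦ by
    have h1 := congrArg (fun y : Plane ↦ y 0) h0
    have h2 := congrArg (fun y : Plane ↦ y 1) h0
    simp at h1 h2
    exact h.elim (· h1) (· h2)
  obtain ⟨f₀, hf₀⟩ := hex !₂[1, 0] (hne _ _ (by simp))
  obtain ⟨f₁, hf₁⟩ := hex !₂[0, 1] (hne _ _ (by simp))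
  obtain ⟨f₂, hf₂⟩ := hex !₂[1, 1] (hne _ _ (by simp))
  have h01 := hB (nullVector !₂[1, 0]) (nullVector !₂[0, 1])
  have h02 := hB (nullVector !₂[1, 0]) (nullVector !₂[1, 1])
  have h12 := hB (nullVector !₂[0, 1]) (nullVector !₂[1, 1])
  rw [← hf₀, ← hf₁, minkowski_nullVector, minkowski_nullVector] at h01
  rw [← hf₀, ← hf₂, minkowski_nullVector, minkowski_nullVector] at h02
  rw [← hf₁, ← hf₂, minkowski_nullVector, minkowski_nullVector] at h12
  rw [← hf₀, ← hf₁, ← hf₂, triple_nullVector] at hv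
  -- Inner products of null vectors are -2ω², so an isometry preserves areas of spinors up to sign;
  -- the square roots f₀, f₁, f₂ themselves are only determined up to sign.
  have hD : planeArea f₀ f₁ ^ 2 = 1 := by simp [planeArea] at h01 ⊢; exact h01
  have hb : planeArea f₀ f₂ ^ 2 = 1 := by simp [planeArea] at h02 ⊢; exact h02
  have ha : planeArea f₁ f₂ ^ 2 = 1 := by simp [planeArea] at h12 ⊢; exact h12
  have hdec := planeArea_smul_eq f₀ f₁ f₂
  set D := planeArea f₀ f₁
  have hanti : planeArea f₂ f₁ = -planeArea f₁ f₂ := by simp only [planeArea]; ring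
  rw [hanti] at hdec
  set r := planeArea f₁ f₂
  set s := planeArea f₀ f₂
  have hf2 : f₂ = (D * -r) • f₀ + (D * s) • f₁ := by
    rw [mul_smul, mul_smul, ← smul_add, ← hdec, smul_smul, ← pow_two, hD, one_smul]
  -- D r s is ±1, and the orientation hypothesis says that it is negative. This excludes lifts of
  -- determinant -1.
  have hdet : -(D * r * s) = 1 := by
    have h1 : (D * r * s) ^ 2 = 1 := by rw [mul_pow, mul_pow, hD, ha, hb]; norm_num
    nlinarith
  -- The scalars -Dr and Ds are the signs for which the images of (1, 0) and (0, 1) add up to f₂, by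
  -- Cramer's rule. Thus g has the right null vectors at (1, 0), (0, 1) and (1, 1), hence everywhere
  -- by polarization.
  refine ⟨(EuclideanSpace.proj 0 : Plane →L[ℝ] ℝ).smulRight ((D * -r) • f₀) +
    (EuclideanSpace.proj 1 : Plane →L[ℝ] ℝ).smulRight ((D * s) • f₁), fun x y ↦ ?_, fun z ↦ ?_⟩
  · have : ∀ p q p' q' : ℝ, planeArea (p • ((D * -r) • f₀) + q • ((D * s) • f₁))
        (p' • ((D * -r) • f₀) + q' • ((D * s) • f₁)) =
        -(D * r * s) * (p * q' - q * p') * D ^ 2 := by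
      intro p q p' q'
      simp only [D, planeArea]
      simp
      ring
    simp only [add_apply, ContinuousLinearMap.smulRight_apply, PiLp.proj_apply]
    rw [this, hdet, hD]
    simp only [planeArea]
    ring
  · have hz : z = z 0 • !₂[1, 0] + z 1 • !₂[0, 1] := by
      ext i
      fin_cases i <;> simp
    have h11 : (!₂[1, 0] + !₂[0, 1] : Plane) = !₂[1, 1] := by
      ext i
      fin_cases i <;> simp
    simp only [add_apply, ContinuousLinearMap.smulRight_apply, PiLp.proj_apply]
    conv_lhs => rw [hz]
    rw [nullVector_smul_add_smul, nullVector_smul_add_smul, h11, ← hf2, nullVector_smul (D * -r),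
      nullVector_smul (D * s), mul_pow, mul_pow, hD, hb, neg_sq, ha, one_mul, one_smul, one_smul]
    simp only [map_add, map_smul, map_sub, hf₀, hf₁, hf₂]

variable {P : Type*} [NormedAddCommGroup P] [NormedSpace ℝ P]
  {Ω : LinearMap.BilinForm ℝ P} {L : TracelessEnd P ≃L[ℝ] Plane × ℝ}

theorem IsLorentzCoord.symm_nullVector_mem (hL : IsLorentzCoord Ω L) {z : Plane} (hz : z ≠ 0) :
    L.symm (nullVector z) ∈ futureNullCone Ω := by
  rw [hL.mem_iff, L.apply_symm_apply]
  exact ⟨snd_nullVector_pos hz, norm_fst_nullVector z⟩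

theorem IsLorentzCoord.mem_lorentzGroup_iff (hL : IsLorentzCoord Ω L)
    {T : (TracelessEnd P →L[ℝ] TracelessEnd P)ˣ} :
    T ∈ lorentzGroup P ↔
      ∀ w, minkowski (L (T.1 (L.symm w))) (L (T.1 (L.symm w))) = minkowski w w := by
  have hm : ∀ A, minkowski (L A) (L A) = 4 * lorentzForm P A := fun A ↦ by
    rw [minkowski_self, hL.lorentzForm_eq]; ring
  constructor
  · intro hT w
    conv_rhs => rw [← L.apply_symm_apply w]
    rw [hm, hm, hT]
  · intro h A
    have := h (L A)
    rw [L.symm_apply_apply, hm, hm] at this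
    linarith

theorem pos_of_mem_lorentzIdentityComponent
    {F : (TracelessEnd P →L[ℝ] TracelessEnd P) → ℝ} (hF : Continuous F)
    (h0 : ∀ T ∈ lorentzGroup P, F T.1 ≠ 0) (h1 : 0 < F 1)
    {T : (TracelessEnd P →L[ℝ] TracelessEnd P)ˣ} (hT : T ∈ lorentzIdentityComponent P) :
    0 < F T.1 :=
  pos_of_mem_identityComponent (W := TracelessEnd P) hF h0 h1 hT

/-- Time components of images of future null vectors, and the triple determinant of three such
images, never vanish on the Lorentz group, so they keep on the identity component the signs that
they have at 1. -/
theorem IsLorentzCoord.exists_nullVector_lift (hL : IsLorentzCoord Ω L)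
    {T : (TracelessEnd P →L[ℝ] TracelessEnd P)ˣ} (hT : T ∈ lorentzIdentityComponent P) :
    ∃ g : Plane →L[ℝ] Plane, (∀ x y, planeArea (g x) (g y) = planeArea x y) ∧
      ∀ z, L (T.1 (L.symm (nullVector z))) = nullVector (g z) := by
  have hTg : T ∈ lorentzGroup P := by
    obtain ⟨t, -, rfl⟩ := hT
    exact t.2
  have hc : ∀ w : Plane × ℝ, Continuous fun T : TracelessEnd P →L[ℝ] TracelessEnd P ↦
      L (T (L.symm w)) := fun w ↦ by fun_prop
  refine _root_.exists_nullVector_lift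
    (S := ((L : TracelessEnd P →L[ℝ] Plane × ℝ).comp T.1).comp
      (L.symm : Plane × ℝ →L[ℝ] TracelessEnd P)) (hL.mem_lorentzGroup_iff.1 hTg) ?_ ?_
  · intro z hz
    refine pos_of_mem_lorentzIdentityComponent (P := P) (T := T)
      (F := fun T ↦ (L (T (L.symm (nullVector z)))).2)
      (continuous_snd.comp (hc (nullVector z))) ?_ ?_ hT
    · intro U hU h0
      have h := hL.mem_lorentzGroup_iff.1 hU (nullVector z)
      -- A null vector with zero time component is zero, which an invertible map cannot produce from
      -- a nonzero null vector.
      rw [minkowski_self, minkowski_self, norm_fst_nullVector, sub_self, h0, zero_pow two_ne_zero,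
        sub_zero, pow_eq_zero_iff two_ne_zero, norm_eq_zero] at h
      have h1 : L (U.1 (L.symm (nullVector z))) = 0 := Prod.ext h h0
      rw [map_eq_zero_iff L L.injective] at h1
      have h2 : L.symm (nullVector z) = 0 := by
        have := congrArg (fun S : TracelessEnd P →L[ℝ] TracelessEnd P ↦
          S (L.symm (nullVector z))) U.inv_mul
        refine this.symm.trans ?_
        change (U⁻¹).1 (U.1 _) = 0
        rw [h1, map_zero]
      rw [map_eq_zero_iff L.symm L.symm.injective] at h2
      have := snd_nullVector_pos hz
      rw [h2] at this
      exact lt_irrefl _ this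
    · change 0 < (L (L.symm (nullVector z))).2
      rw [L.apply_symm_apply]
      exact snd_nullVector_pos hz
  · rw [← neg_pos]
    refine pos_of_mem_lorentzIdentityComponent (P := P) (T := T)
      (F := fun T ↦ -triple (L (T (L.symm (nullVector !₂[1, 0]))))
        (L (T (L.symm (nullVector !₂[0, 1])))) (L (T (L.symm (nullVector !₂[1, 1]))))) ?_ ?_ ?_ hT
    · have h0 := hc (nullVector !₂[1, 0])
      have h1 := hc (nullVector !₂[0, 1])
      have h2 := hc (nullVector !₂[1, 1])
      exact (continuous_triple.comp (h0.prodMk (h1.prodMk h2))).neg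
    · intro U hU h0
      rw [neg_eq_zero] at h0
      have hq := hL.mem_lorentzGroup_iff.1 hU
      have hB : ∀ v w, minkowski (L (U.1 (L.symm v))) (L (U.1 (L.symm w))) = minkowski v w :=
        fun v w ↦ by
          rw [minkowski_eq, minkowski_eq v, ← hq v, ← hq w, ← hq (v + w), map_add, map_add, map_add]
      -- If the triple determinant vanished, so would the Gram determinant, but the latter is the
      -- same as for the three original null vectors, where it is not zero.
      have h := triple_sq (L (U.1 (L.symm (nullVector !₂[1, 0]))))
        (L (U.1 (L.symm (nullVector !₂[0, 1])))) (L (U.1 (L.symm (nullVector !₂[1, 1]))))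
      simp only [h0, hB, minkowski_nullVector] at h
      simp [planeArea] at h
    · change 0 < -triple (L (L.symm (nullVector !₂[1, 0])))
        (L (L.symm (nullVector !₂[0, 1]))) (L (L.symm (nullVector !₂[1, 1])))
      simp only [L.apply_symm_apply, triple_nullVector]
      simp [planeArea]

/-- Transports a one-parameter group of Minkowski isometries to V. Pointwise continuity suffices
because V is finite-dimensional. -/
theorem IsLorentzCoord.exists_mem_identityComponent (hL : IsLorentzCoord Ω L)
    {ρ : ℝ → Plane × ℝ →L[ℝ] Plane × ℝ} (hρ : ∀ w, Continuous fun t ↦ ρ t w)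
    (hρ0 : ∀ w, ρ 0 w = w) (hinv : ∀ t w, ρ t (ρ (-t) w) = w)
    (hS : ∀ t w, minkowski (ρ t w) (ρ t w) = minkowski w w) (t : ℝ) :
    ∃ T ∈ lorentzIdentityComponent P, ∀ A, L (T.1 A) = ρ t (L A) := by
  have hfin : FiniteDimensional ℝ (TracelessEnd P) := L.symm.toLinearEquiv.finiteDimensional
  let ρ' : ℝ → TracelessEnd P →L[ℝ] TracelessEnd P := fun t ↦
    ((L.symm : Plane × ℝ →L[ℝ] TracelessEnd P).comp (ρ t)).comp
      (L : TracelessEnd P →L[ℝ] Plane × ℝ)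
  have hρ' : ∀ t A, ρ' t A = L.symm (ρ t (L A)) := fun _ _ ↦ rfl
  obtain ⟨T, hT, hT'⟩ := _root_.exists_mem_identityComponent (S := lorentzGroup P) (ρ := ρ')
    (continuous_clm_apply.2 fun A ↦ L.symm.continuous.comp (hρ (L A)))
    (by ext1 A; rw [hρ', hρ0, L.symm_apply_apply]; rfl)
    (fun t ↦ by
      ext1 A
      change ρ' t (ρ' (-t) A) = A
      rw [hρ', hρ', L.apply_symm_apply, hinv, L.symm_apply_apply])
    (fun T ⟨t, ht⟩ ↦ hL.mem_lorentzGroup_iff.2 fun w ↦ by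
      rw [ht, hρ', L.apply_symm_apply, L.apply_symm_apply, hS]) t
  exact ⟨T, hT, fun A ↦ by rw [hT', hρ', L.apply_symm_apply]⟩

/-- The rotation by the angle `t` of Minkowski space. -/
def spaceRotation (t : ℝ) : Plane × ℝ →L[ℝ] Plane × ℝ := LinearMap.toContinuousLinearMap
  { toFun := fun w ↦ (!₂[Real.cos t * w.1 0 - Real.sin t * w.1 1,
      Real.sin t * w.1 0 + Real.cos t * w.1 1], w.2)
    map_add' := by
      intro v w
      ext i
      · fin_cases i <;> simp <;> ring
      · simp
    map_smul' := by
      intro r w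
      ext i
      · fin_cases i <;> simp <;> ring
      · simp }

theorem spaceRotation_apply (t : ℝ) (w : Plane × ℝ) : spaceRotation t w =
    (!₂[Real.cos t * w.1 0 - Real.sin t * w.1 1, Real.sin t * w.1 0 + Real.cos t * w.1 1], w.2) :=
  rfl

/-- The boost by the rapidity `t` of Minkowski space. -/
def lorentzBoost (t : ℝ) : Plane × ℝ →L[ℝ] Plane × ℝ := LinearMap.toContinuousLinearMap
  { toFun := fun w ↦ (!₂[Real.cosh t * w.1 0 + Real.sinh t * w.2, w.1 1],
      Real.sinh t * w.1 0 + Real.cosh t * w.2)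
    map_add' := by
      intro v w
      ext i
      · fin_cases i
        · simp; ring
        · simp
      · simp; ring
    map_smul' := by
      intro r w
      ext i
      · fin_cases i
        · simp; ring
        · simp
      · simp; ring }

theorem lorentzBoost_apply (t : ℝ) (w : Plane × ℝ) : lorentzBoost t w =
    (!₂[Real.cosh t * w.1 0 + Real.sinh t * w.2, w.1 1],
      Real.sinh t * w.1 0 + Real.cosh t * w.2) :=
  rfl

theorem IsLorentzCoord.exists_rotation (hL : IsLorentzCoord Ω L) (t : ℝ) :
    ∃ T ∈ lorentzIdentityComponent P, ∀ A, L (T.1 A) = spaceRotation t (L A) := by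
  refine hL.exists_mem_identityComponent (fun w ↦ ?_) (fun w ↦ ?_) (fun t w ↦ ?_) (fun t w ↦ ?_) t
  · simp only [spaceRotation_apply]
    fun_prop
  · ext i
    · fin_cases i <;> simp [spaceRotation_apply]
    · simp [spaceRotation_apply]
  · have h := Real.sin_sq_add_cos_sq t
    ext i
    · fin_cases i
      · simp [spaceRotation_apply]
        linear_combination w.1 0 * h
      · simp [spaceRotation_apply]
        linear_combination w.1 1 * h
    · simp [spaceRotation_apply]
  · have h := Real.sin_sq_add_cos_sq t
    simp [spaceRotation_apply, minkowski]
    linear_combination (w.1 0 ^ 2 + w.1 1 ^ 2) * h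

theorem IsLorentzCoord.exists_boost (hL : IsLorentzCoord Ω L) (t : ℝ) :
    ∃ T ∈ lorentzIdentityComponent P, ∀ A, L (T.1 A) = lorentzBoost t (L A) := by
  refine hL.exists_mem_identityComponent (fun w ↦ ?_) (fun w ↦ ?_) (fun t w ↦ ?_) (fun t w ↦ ?_) t
  · simp only [lorentzBoost_apply]
    have := Real.continuous_cosh
    have := Real.continuous_sinh
    fun_prop
  · ext i
    · fin_cases i <;> simp [lorentzBoost_apply]
    · simp [lorentzBoost_apply]
  · have h := Real.cosh_sq_sub_sinh_sq t
    ext i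
    · fin_cases i
      · simp [lorentzBoost_apply]
        linear_combination w.1 0 * h
      · simp [lorentzBoost_apply]
    · simp [lorentzBoost_apply]
      linear_combination w.2 * h
  · have h := Real.cosh_sq_sub_sinh_sq t
    simp [lorentzBoost_apply, minkowski]
    linear_combination (w.1 0 ^ 2 - w.2 ^ 2) * h

theorem IsLorentzCoord.mapsTo (hL : IsLorentzCoord Ω L)
    {T : (TracelessEnd P →L[ℝ] TracelessEnd P)ˣ} (hT : T ∈ lorentzIdentityComponent P) :
    Set.MapsTo T.1 (futureNullCone Ω) (futureNullCone Ω) := by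
  obtain ⟨g, hg, hg'⟩ := hL.exists_nullVector_lift hT
  intro A hA
  obtain ⟨h1, h2⟩ := (hL.mem_iff A).1 hA
  obtain ⟨z, hz, hzA⟩ := exists_nullVector_eq h1 h2
  have hA' : A = L.symm (nullVector z) := by rw [hzA, L.symm_apply_apply]
  have h3 : T.1 A = L.symm (nullVector (g z)) := by
    rw [hA', ← hg', L.symm_apply_apply]
  rw [h3]
  refine hL.symm_nullVector_mem fun h0 ↦ hz ?_
  -- The area spanned by z and its rotation by a right angle is |z|²; g preserves it, so g z = 0
  -- would force z = 0.
  have := hg z !₂[-(z 1), z 0]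
  rw [h0] at this
  by_contra hz'
  have h4 := sq_add_sq_pos_of_ne_zero hz'
  simp [planeArea] at this
  nlinarith

/-- Every future null vector is reached from ((1, 0), 1): the boost of rapidity log τ multiplies it
by cosh + sinh = τ, and a rotation then gives u its argument. -/
theorem IsLorentzCoord.exists_map_eq (hL : IsLorentzCoord Ω L) {A B : TracelessEnd P}
    (hA : A ∈ futureNullCone Ω) (hB : B ∈ futureNullCone Ω) :
    ∃ T ∈ lorentzIdentityComponent P, T.1 A = B := by
  have key : ∀ A ∈ futureNullCone Ω, ∃ T ∈ lorentzIdentityComponent P,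
      T.1 (L.symm (!₂[1, 0], 1)) = A := by
    intro A hA
    obtain ⟨h1, h2⟩ := (hL.mem_iff A).1 hA
    obtain ⟨S, hS, hS'⟩ := hL.exists_boost (Real.log (L A).2)
    obtain ⟨R, hR, hR'⟩ := hL.exists_rotation (Complex.arg ⟨(L A).1 0, (L A).1 1⟩)
    refine ⟨R * S, mul_mem hR hS, L.injective ?_⟩
    have hn : ‖(⟨(L A).1 0, (L A).1 1⟩ : ℂ)‖ = (L A).2 := by
      rw [← h2, EuclideanSpace.norm_eq, Complex.norm_eq_sqrt_sq_add_sq]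
      simp
    have hc := Complex.norm_mul_cos_arg (⟨(L A).1 0, (L A).1 1⟩ : ℂ)
    have hs := Complex.norm_mul_sin_arg (⟨(L A).1 0, (L A).1 1⟩ : ℂ)
    rw [hn] at hc hs
    have he := Real.cosh_add_sinh (Real.log (L A).2)
    rw [Real.exp_log h1] at he
    change L (R.1 (S.1 _)) = L A
    rw [hR', hS', L.apply_symm_apply, lorentzBoost_apply, spaceRotation_apply]
    ext i
    · fin_cases i
      · simp [he]
        linarith
      · simp [he]
        linarith
    · simp [Real.exp_log h1]
  obtain ⟨S, hS, rfl⟩ := key A hA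
  obtain ⟨T, hT, rfl⟩ := key B hB
  refine ⟨T * S⁻¹, mul_mem hT (inv_mem hS), ?_⟩
  have := congrArg (fun U : TracelessEnd P →L[ℝ] TracelessEnd P ↦
    U (L.symm (!₂[1, 0], 1))) S.inv_mul
  exact congrArg T.1 this

end NullVectors

/-! ## The future null cone as an embedded surface -/

section ConeChart

variable {P : Type*} [NormedAddCommGroup P] [NormedSpace ℝ P]
  {Ω : LinearMap.BilinForm ℝ P} {L : TracelessEnd P ≃L[ℝ] Plane × ℝ}

theorem IsLorentzCoord.symm_norm_mem (hL : IsLorentzCoord Ω L) {u : Plane} (hu : u ≠ 0) :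
    L.symm (u, ‖u‖) ∈ futureNullCone Ω := by
  rw [hL.mem_iff, L.apply_symm_apply]
  exact ⟨norm_pos_iff.2 hu, rfl⟩

theorem IsLorentzCoord.apply_eq (hL : IsLorentzCoord Ω L) (A : futureNullCone Ω) :
    L A.1 = ((L A.1).1, ‖(L A.1).1‖) :=
  Prod.ext rfl ((hL.mem_iff A.1).1 A.2).2.symm

theorem IsLorentzCoord.fst_ne_zero (hL : IsLorentzCoord Ω L) (A : futureNullCone Ω) :
    (L A.1).1 ≠ 0 := by
  obtain ⟨h1, h2⟩ := (hL.mem_iff A.1).1 A.2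
  rw [← norm_pos_iff, h2]
  exact h1

/-- The point of the future null cone with prescribed spatial component (a junk value at `0`). -/
def coneLift (hL : IsLorentzCoord Ω L) (u : Plane) : futureNullCone Ω :=
  open Classical in
  if hu : u = 0 then ⟨L.symm (nullVector !₂[1, 0]), hL.symm_nullVector_mem (by
    intro h
    simpa using congrArg (fun y : Plane ↦ y 0) h)⟩
  else ⟨L.symm (u, ‖u‖), hL.symm_norm_mem hu⟩

theorem coneLift_coe (hL : IsLorentzCoord Ω L) {u : Plane} (hu : u ≠ 0) :
    (coneLift hL u).1 = L.symm (u, ‖u‖) := by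
  rw [coneLift, dif_neg hu]

/-- The projection of the future null cone to the space component. -/
def coneChart (hL : IsLorentzCoord Ω L) : OpenPartialHomeomorph (futureNullCone Ω) Plane where
  toFun A := (L A.1).1
  invFun := coneLift hL
  source := Set.univ
  target := {0}ᶜ
  map_source' A _ := hL.fst_ne_zero A
  map_target' _ _ := Set.mem_univ _
  left_inv' A _ := Subtype.ext <| by
    rw [coneLift_coe hL (hL.fst_ne_zero A), ← hL.apply_eq, L.symm_apply_apply]
  right_inv' u hu := by rw [coneLift_coe hL hu, L.apply_symm_apply]
  open_source := isOpen_univ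
  open_target := isOpen_compl_singleton
  continuousOn_toFun := by fun_prop
  continuousOn_invFun := by
    rw [Topology.IsInducing.subtypeVal.continuousOn_iff]
    refine ContinuousOn.congr (f := fun u ↦ L.symm (u, ‖u‖)) ?_ fun u hu ↦ coneLift_coe hL hu
    fun_prop

theorem coneChart_apply (hL : IsLorentzCoord Ω L) (A : futureNullCone Ω) :
    coneChart hL A = (L A.1).1 := rfl

theorem coneChart_symm_coe (hL : IsLorentzCoord Ω L) {u : Plane} (hu : u ≠ 0) :
    ((coneChart hL).symm u).1 = L.symm (u, ‖u‖) := coneLift_coe hL hu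

theorem coneChart_target (hL : IsLorentzCoord Ω L) : (coneChart hL).target = {0}ᶜ := rfl

/-- The chart of `Plane × ℝ` (away from the time axis) which straightens the null cone. -/
def straightenCone : OpenPartialHomeomorph (Plane × ℝ) (Plane × ℝ) where
  toFun w := (w.1, w.2 - ‖w.1‖)
  invFun w := (w.1, w.2 + ‖w.1‖)
  source := {0}ᶜ ×ˢ Set.univ
  target := {0}ᶜ ×ˢ Set.univ
  map_source' _ hw := hw
  map_target' _ hw := hw
  left_inv' w _ := by simp
  right_inv' w _ := by simp
  open_source := isOpen_compl_singleton.prod isOpen_univ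
  open_target := isOpen_compl_singleton.prod isOpen_univ
  continuousOn_toFun := by fun_prop
  continuousOn_invFun := by fun_prop

theorem contDiffOn_norm_fst :
    ContDiffOn ℝ ∞ (fun w : Plane × ℝ ↦ ‖w.1‖) ({0}ᶜ ×ˢ Set.univ) :=
  contDiffOn_fst.norm ℝ fun _ hw ↦ hw.1

/-- The chart which straightens the null cone, transported by a linear equivalence. -/
def straightenChart {W : Type*} [NormedAddCommGroup W] [NormedSpace ℝ W]
    (L : W ≃L[ℝ] Plane × ℝ) :
    OpenPartialHomeomorph (W) (W) :=
  (L.toHomeomorph.transOpenPartialHomeomorph straightenCone).transHomeomorph L.symm.toHomeomorph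

theorem straightenChart_mem_maximalAtlas {W : Type*} [NormedAddCommGroup W] [NormedSpace ℝ W]
    (L : W ≃L[ℝ] Plane × ℝ) :
    straightenChart L ∈ IsManifold.maximalAtlas 𝓘(ℝ, W) ∞ (W) := by
  have key : ∀ F : Plane × ℝ → Plane × ℝ, ContDiffOn ℝ ∞ F ({0}ᶜ ×ˢ Set.univ) →
      ContDiffOn ℝ ∞ (fun A ↦ L.symm (F (L A))) (L ⁻¹' ({0}ᶜ ×ˢ Set.univ)) := fun F hF ↦ by
    have h1 : ContDiffOn ℝ ∞ (fun A ↦ F (L A)) (L ⁻¹' ({0}ᶜ ×ˢ Set.univ)) :=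
      hF.comp L.contDiff.contDiffOn fun _ h ↦ h
    exact L.symm.contDiff.comp_contDiffOn h1
  refine OpenPartialHomeomorph.mem_maximalAtlas_of_contMDiffOn (I := 𝓘(ℝ, W))
    (straightenChart L) ?_ ?_
  · rw [contMDiffOn_iff_contDiffOn]
    exact key (fun w ↦ (w.1, w.2 - ‖w.1‖))
      (contDiffOn_fst.prodMk (contDiffOn_snd.sub contDiffOn_norm_fst))
  · rw [contMDiffOn_iff_contDiffOn]
    exact key (fun w ↦ (w.1, w.2 + ‖w.1‖))
      (contDiffOn_fst.prodMk (contDiffOn_snd.add contDiffOn_norm_fst))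

/-- A map which is a graph over the null cone in a global chart is a smooth embedding. -/
theorem isSmoothEmbedding_of_cone {W : Type*} [NormedAddCommGroup W] [NormedSpace ℝ W]
    (L : W ≃L[ℝ] Plane × ℝ) {M : Type*} [TopologicalSpace M] [ChartedSpace Plane M]
    [IsManifold (𝓡 2) ∞ M] {φ : OpenPartialHomeomorph M Plane} (h : IsGlobalChart φ)
    (hφ : φ.target = {0}ᶜ) {ι : M → W} (hι : Topology.IsEmbedding ι)
    (hιφ : ∀ u ≠ 0, ι (φ.symm u) = L.symm (u, ‖u‖)) :
    Manifold.IsSmoothEmbedding (𝓡 2) 𝓘(ℝ, W) ∞ ι := by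
  -- The normal direction is ℝ: after subtracting |u| from the time coordinate the map reads u ↦ (u,
  -- 0).
  refine ⟨Manifold.IsImmersionOfComplement.isImmersion (F := ℝ) fun x ↦ ?_, hι⟩
  refine Manifold.IsImmersionAtOfComplement.mk_of_continuousAt
    hι.continuous.continuousAt L.symm φ (straightenChart L)
    (h.mem_source x) ?_ ?_ (straightenChart_mem_maximalAtlas L) ?_
  · have hx : φ x ∈ ({0}ᶜ : Set Plane) := hφ ▸ h.apply_mem_target x
    have h1 := hιφ (φ x) hx
    rw [h.symm_apply] at h1
    change L (ι x) ∈ ({0}ᶜ : Set Plane) ×ˢ (Set.univ : Set ℝ)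
    rw [h1, L.apply_symm_apply]
    exact ⟨hx, Set.mem_univ _⟩
  · rw [← h.chartAt_eq x]
    exact IsManifold.chart_mem_maximalAtlas x
  · intro u hu
    have hu' : u ≠ 0 := by
      simp [hφ] at hu
      exact hu
    have : (straightenChart L).extend 𝓘(ℝ, W) (ι (φ.symm u)) = L.symm (u, 0) := by
      rw [hιφ u hu']
      change L.symm ((L (L.symm (u, ‖u‖))).1,
        (L (L.symm (u, ‖u‖))).2 - ‖(L (L.symm (u, ‖u‖))).1‖) = _
      simp
    exact this

theorem isSmoothEmbedding_futureNullCone (hL : IsLorentzCoord Ω L)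
    [ChartedSpace Plane (futureNullCone Ω)] [IsManifold (𝓡 2) ∞ (futureNullCone Ω)]
    (h : IsGlobalChart (coneChart hL)) :
    Manifold.IsSmoothEmbedding (𝓡 2) 𝓘(ℝ, TracelessEnd P) ∞
      (Subtype.val : futureNullCone Ω → TracelessEnd P) :=
  isSmoothEmbedding_of_cone (W := TracelessEnd P) L h (coneChart_target hL) .subtypeVal
    fun _ ↦ coneChart_symm_coe hL

end ConeChart

/-! ## The connections on a surface with a global chart onto the punctured plane -/

section ConeSurface

variable {M : Type*} [TopologicalSpace M] [ChartedSpace Plane M]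
  {φ : OpenPartialHomeomorph M Plane}

theorem IsGlobalChart.apply_ne_zero (h : IsGlobalChart φ) (hφ : φ.target = {0}ᶜ) (A : M) :
    φ A ≠ 0 := by
  have := h.apply_mem_target A
  rwa [hφ] at this

variable [IsManifold (𝓡 2) ∞ M]

/-- The endomorphism y ↦ R(v, y) z has rank at most one, a linear functional of y times z, so its
trace is the functional evaluated at z. The outcome is visibly skew. -/
theorem ricci_coneConnection (h : IsGlobalChart φ) (hφ : φ.target = {0}ᶜ) (d : ℝ) (A : M)
    (v z : Plane) : ricci (christoffelConnection h (coneChristoffel d)) A v z =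
      3 * d / 4 * ‖φ A‖⁻¹ * (z 0 * v 1 - z 1 * v 0) := by
  rw [ricci_christoffelConnection]
  simp only [coneChristoffel_curvature d (h.apply_ne_zero hφ A)]
  set b := Module.finBasis ℝ Plane
  have hz := b.sum_repr z
  have hi : ∀ i : Fin 2, z i = ∑ j, b.repr z j * b j i := fun i ↦ by
    exact (congrArg (fun y : Plane ↦ y i) hz.symm).trans (by simp [-Module.Basis.sum_repr])
  rw [hi 0, hi 1, Finset.sum_mul, Finset.sum_mul, ← Finset.sum_sub_distrib, Finset.mul_sum]
  refine Finset.sum_congr rfl fun i _ ↦ ?_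
  rw [map_smul, smul_eq_mul, Module.Basis.coord_apply]
  ring

theorem isNonzeroRSTS_coneConnection (h : IsGlobalChart φ) (hφ : φ.target = {0}ᶜ) {d : ℝ}
    (hd : d ≠ 0) : IsNonzeroRSTS (christoffelConnection h (coneChristoffel d)) where
  smooth := contMDiff_christoffelConnection h (hφ ▸ contDiffOn_coneChristoffel d)
  torsionFree := by
    have : IsManifold (𝓡 2) 2 M := IsManifold.of_le (n := ∞) ENat.LEInfty.out
    exact torsion_christoffelConnection h (coneChristoffel_symm d)
  ricci_skew A v z := by
    rw [ricci_coneConnection h hφ d A v z, ricci_coneConnection h hφ d A z v]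
    ring
  ricci_ne_zero A := by
    refine ⟨(!₂[0, 1] : Plane), (!₂[1, 0] : Plane), ?_⟩
    rw [ricci_coneConnection h hφ]
    have := norm_ne_zero_iff.2 (h.apply_ne_zero hφ A)
    simp [hd, this]

theorem coneConnection_ne (h : IsGlobalChart φ) (hφ : φ.target = {0}ᶜ) {d d' : ℝ} (hd : d ≠ d') :
    ∃ (X : Π A : M, TangentSpace (𝓡 2) A) (A : M), SmoothFieldAt X A ∧
      christoffelConnection h (coneChristoffel d) X A ≠
        christoffelConnection h (coneChristoffel d') X A := by
  let X : Π A : M, TangentSpace (𝓡 2) A := fun _ ↦ (!₂[0, 1] : Plane)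
  have hX : coordField φ X = fun _ ↦ !₂[0, 1] := rfl
  have hu : (!₂[1, 0] : Plane) ∈ φ.target := by
    rw [hφ]
    intro h
    simpa using congrArg (fun y : Plane ↦ y 0) h
  -- At u = (1, 0) the second component of Γ(e₁, e₁) is the parameter itself, so the constant field
  -- e₁ distinguishes the connections.
  refine ⟨X, φ.symm !₂[1, 0], ?_, fun hne ↦ hd ?_⟩
  · rw [h.smoothFieldAt_iff, hX]
    exact contDiffAt_const
  · have hn : ‖(!₂[1, 0] : Plane)‖ = 1 := by simp [EuclideanSpace.norm_eq]
    have key : ∀ c : ℝ, (show Plane from christoffelConnection h (coneChristoffel c) X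
        (φ.symm !₂[1, 0]) (!₂[0, 1] : Plane)) 1 = c := by
      intro c
      refine (congrArg (fun y : Plane ↦ y 1)
        (christoffelConnection_apply h (coneChristoffel c) X _ _)).trans ?_
      rw [hX, φ.right_inv hu]
      simp [coneChristoffel, coneCoeff_apply_one, hn]
    rw [← key d, ← key d']
    exact congrArg (fun T : Plane →L[ℝ] Plane ↦ T !₂[0, 1] 1) hne

theorem contMDiffOn_coneConnection (h : IsGlobalChart φ) (hφ : φ.target = {0}ᶜ)
    {X Y : Π A : M, TangentSpace (𝓡 2) A} (hX : ∀ A, SmoothFieldAt X A)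
    (hY : ∀ A, SmoothFieldAt Y A) (s : Set (ℝ × M)) :
    ContMDiffOn (𝓘(ℝ, ℝ).prod (𝓡 2)) (𝓡 2).tangent ∞
      (fun q : ℝ × M ↦ (⟨q.2, christoffelConnection h (coneChristoffel q.1) Y q.2 (X q.2)⟩ :
        TangentBundle (𝓡 2) M)) s := by
  intro q _
  refine ContMDiffAt.contMDiffWithinAt ?_
  rw [Bundle.contMDiffAt_totalSpace]
  refine ⟨contMDiffAt_snd, ?_⟩
  simp only [h.trivializationAt_apply]
  let K : ℝ × Plane → Plane := fun p ↦ fderiv ℝ (coordField φ Y) p.2 (coordField φ X p.2) +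
    coneChristoffel p.1 p.2 (coordField φ Y p.2) (coordField φ X p.2)
  have hX' := h.smoothFieldAt_iff.1 (hX q.2)
  have hY' := h.smoothFieldAt_iff.1 (hY q.2)
  have hs : ContDiffAt ℝ ∞ (Prod.snd : ℝ × Plane → Plane) (q.1, φ q.2) := contDiffAt_snd
  have hX2 : ContDiffAt ℝ ∞ (fun p : ℝ × Plane ↦ coordField φ X p.2) (q.1, φ q.2) :=
    ContDiffAt.comp (g := coordField φ X) (q.1, φ q.2) hX' hs
  have hY2 : ContDiffAt ℝ ∞ (fun p : ℝ × Plane ↦ coordField φ Y p.2) (q.1, φ q.2) :=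
    ContDiffAt.comp (g := coordField φ Y) (q.1, φ q.2) hY' hs
  have hY3 : ContDiffAt ℝ ∞ (fun p : ℝ × Plane ↦ fderiv ℝ (coordField φ Y) p.2) (q.1, φ q.2) :=
    ContDiffAt.comp (g := fderiv ℝ (coordField φ Y)) (q.1, φ q.2)
      (hY'.fderiv_right (by simp)) hs
  have hK : ContDiffAt ℝ ∞ K (q.1, φ q.2) :=
    (hY3.clm_apply hX2).add
      (((contDiffAt_coneChristoffel (q := (q.1, φ q.2)) (h.apply_ne_zero hφ q.2)).clm_apply
        hY2).clm_apply hX2)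
  have hφs : ContMDiffAt (𝓡 2) 𝓘(ℝ, Plane) ∞ φ q.2 :=
    h.contMDiffAt_vector_iff.2 (contDiffAt_id.congr_of_eventuallyEq (h.eventually_apply_symm q.2))
  have hp : ContMDiffAt (𝓘(ℝ, ℝ).prod (𝓡 2)) 𝓘(ℝ, ℝ × Plane) ∞
      (fun q : ℝ × M ↦ (q.1, φ q.2)) q :=
    contMDiffAt_fst.prodMk_space (hφs.comp q contMDiffAt_snd)
  refine (hK.contMDiffAt.comp q hp).congr_of_eventuallyEq (.of_forall fun p ↦ ?_)
  refine (christoffelConnection_apply h (coneChristoffel p.1) Y p.2 (X p.2)).trans ?_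
  simp only [K, Function.comp_apply, h.coordField_apply]
  rfl

/-- A bijection of the surface that is covered by an area-preserving linear map of spinors is an
affine diffeomorphism. -/
theorem isAffineDiffeoAt_of_lift (h : IsGlobalChart φ) (hφ : φ.target = {0}ᶜ) (d : ℝ)
    {f f' : M → M} (hf : Continuous f) (hf' : Continuous f')
    (hs : ∀ A, ContDiffAt ℝ ∞ (φ ∘ f ∘ φ.symm) (φ A))
    (hs' : ∀ A, ContDiffAt ℝ ∞ (φ ∘ f' ∘ φ.symm) (φ A))
    (hff' : Function.LeftInverse f' f) (hf'f : Function.RightInverse f' f)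
    {g : Plane →L[ℝ] Plane} (hg : ∀ x y, planeArea (g x) (g y) = planeArea x y)
    (hfg : ∀ z, z ≠ 0 → φ (f (φ.symm (planeSquare z))) = planeSquare (g z)) (A : M) :
    IsAffineDiffeoAt (christoffelConnection h (coneChristoffel d))
      (christoffelConnection h (coneChristoffel d)) f A := by
  let D : PartialDiffeomorph (𝓡 2) (𝓡 2) M M ∞ :=
    { toFun := f
      invFun := f'
      source := Set.univ
      target := Set.univ
      map_source' := fun _ _ ↦ Set.mem_univ _
      map_target' := fun _ _ ↦ Set.mem_univ _
      left_inv' := fun A _ ↦ hff' A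
      right_inv' := fun A _ ↦ hf'f A
      open_source := isOpen_univ
      open_target := isOpen_univ
      contMDiffOn_toFun := fun A _ ↦
        ((h.contMDiffAt_iff h).2 ⟨hf.continuousAt, hs A⟩).contMDiffWithinAt
      contMDiffOn_invFun := fun A _ ↦
        ((h.contMDiffAt_iff h).2 ⟨hf'.continuousAt, hs' A⟩).contMDiffWithinAt }
  refine isAffineDiffeoAt_of_isAffineAt h h (hasChristoffel_christoffelConnection h _)
    (hasChristoffel_christoffelConnection h _) D (Set.mem_univ A) (fun _ _ ↦ rfl) fun B _ ↦ ?_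
  obtain ⟨z, hz⟩ := exists_planeSquare_eq (φ B)
  have hz0 : z ≠ 0 := by
    rintro rfl
    refine h.apply_ne_zero hφ B (hz.symm.trans ?_)
    ext i
    fin_cases i <;> simp
  have hs2 := (hs B).of_le (m := 2) ENat.LEInfty.out
  have hsq : ContDiff ℝ 2 planeSquare := contDiff_planeSquare.of_le ENat.LEInfty.out
  rw [← hz] at hs2 ⊢
  -- Cancel the squaring map: f composed with it equals the squaring map after g, a composite of
  -- affine maps.
  refine IsAffineAt.of_comp hs2 hsq.contDiffAt (isAffineAt_planeSquare d hz0)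
    (surjective_fderiv_planeSquare hz0) ?_
  have hgz : g z ≠ 0 := by
    intro h0
    have := hg z !₂[-(z 1), z 0]
    rw [h0] at this
    have h4 := sq_add_sq_pos_of_ne_zero hz0
    simp [planeArea] at this
    nlinarith
  refine (IsAffineAt.comp hsq.contDiffAt g.contDiff.contDiffAt (isAffineAt_planeSquare d hgz)
    (isAffineAt_planeChristoffel d g hg z)).congr ?_
  filter_upwards [isOpen_compl_singleton.mem_nhds hz0] with w hw
  exact (hfg w hw).symm

end ConeSurface

/-! ## Local equivalence with the model connection -/

section ModelEquivalence

/-- The square of `ω(z, e)` as a function of `u = z²`. -/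
def areaSq (e u : Plane) : ℝ :=
  (‖u‖ + u 0) / 2 * e 1 ^ 2 - u 1 * (e 0 * e 1) + (‖u‖ - u 0) / 2 * e 0 ^ 2

/-- The product `ω(f, z) ω(z, e)` as a function of `u = z²`. -/
def areaProd (e f u : Plane) : ℝ :=
  u 1 / 2 * (f 0 * e 1 + e 0 * f 1) - (‖u‖ + u 0) / 2 * (e 1 * f 1) -
    (‖u‖ - u 0) / 2 * (e 0 * f 0)

/-- Only even expressions in z are functions of u. Here z₀² = (|u| + u₀)/2, z₁² = (|u| - u₀)/2 and
z₀z₁ = u₁/2. -/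
theorem areaSq_planeSquare (e z : Plane) : areaSq e (planeSquare z) = planeArea z e ^ 2 := by
  simp [areaSq, norm_planeSquare, planeArea]
  ring

theorem areaProd_planeSquare (e f z : Plane) :
    areaProd e f (planeSquare z) = planeArea f z * planeArea z e := by
  simp [areaProd, norm_planeSquare, planeArea]
  ring

theorem ne_zero_of_areaSq_pos {e u : Plane} (h : 0 < areaSq e u) : u ≠ 0 := by
  rintro rfl
  simp [areaSq] at h

theorem continuous_areaSq (e : Plane) : Continuous (areaSq e) := by
  unfold areaSq
  fun_prop

theorem contDiffAt_areaSq (e : Plane) {u : Plane} (hu : u ≠ 0) : ContDiffAt ℝ ∞ (areaSq e) u := by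
  have hn : ContDiffAt ℝ ∞ (fun u : Plane ↦ ‖u‖) u := contDiffAt_norm ℝ hu
  unfold areaSq
  fun_prop

theorem contDiffAt_areaProd (e f : Plane) {u : Plane} (hu : u ≠ 0) :
    ContDiffAt ℝ ∞ (areaProd e f) u := by
  have hn : ContDiffAt ℝ ∞ (fun u : Plane ↦ ‖u‖) u := contDiffAt_norm ℝ hu
  unfold areaProd
  fun_prop

/-- The inverse of `planeSquare ∘ modelParam (2 / d) s₀ e f`. -/
def modelChart (d s₀ : ℝ) (e f u : Plane) : ℝ × ℝ :=
  (s₀ + d / 2 * (areaProd e f u / areaSq e u), Real.log (areaSq e u) / 2)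

theorem contDiffAt_modelChart (d s₀ : ℝ) (e f : Plane) {u : Plane} (hu : 0 < areaSq e u) :
    ContDiffAt ℝ ∞ (modelChart d s₀ e f) u := by
  have h1 := contDiffAt_areaSq e (ne_zero_of_areaSq_pos hu)
  have h2 := contDiffAt_areaProd e f (ne_zero_of_areaSq_pos hu)
  exact (contDiffAt_const.add (contDiffAt_const.mul (h2.div h1 hu.ne'))).prodMk
    ((h1.log hu.ne').div_const 2)

variable {d : ℝ} {e f : Plane}

theorem planeArea_modelParam (k s₀ : ℝ) (hef : planeArea f e = 1) (p : ℝ × ℝ) :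
    planeArea (modelParam k s₀ e f p) e = Real.exp p.2 := by
  have : planeArea (modelParam k s₀ e f p) e = Real.exp p.2 * planeArea f e := by
    simp [planeArea, modelParam]; ring
  rw [this, hef, mul_one]

theorem areaSq_modelParam (k s₀ : ℝ) (hef : planeArea f e = 1) (p : ℝ × ℝ) :
    areaSq e (planeSquare (modelParam k s₀ e f p)) = Real.exp p.2 ^ 2 := by
  rw [areaSq_planeSquare, planeArea_modelParam k s₀ hef]

theorem modelChart_modelParam (hd : d ≠ 0) (s₀ : ℝ) (hef : planeArea f e = 1) (p : ℝ × ℝ) :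
    modelChart d s₀ e f (planeSquare (modelParam (2 / d) s₀ e f p)) = p := by
  have h1 : planeArea f (modelParam (2 / d) s₀ e f p) =
      Real.exp p.2 * (2 / d * (p.1 - s₀)) * planeArea f e := by
    simp [planeArea, modelParam]; ring
  rw [modelChart, areaSq_modelParam _ s₀ hef, areaProd_planeSquare, planeArea_modelParam _ s₀ hef,
    h1, hef]
  have he := (Real.exp_pos p.2).ne'
  ext
  · simp
    field_simp
    ring
  · simp

theorem planeSquare_neg (z : Plane) : planeSquare (-z) = planeSquare z := by
  ext i
  fin_cases i <;> simp

theorem planeSquare_modelParam_modelChart (hd : d ≠ 0) (s₀ : ℝ) (hef : planeArea f e = 1)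
    {u : Plane} (hu : 0 < areaSq e u) :
    planeSquare (modelParam (2 / d) s₀ e f (modelChart d s₀ e f u)) = u := by
  have key : ∀ z, 0 < planeArea z e →
      modelParam (2 / d) s₀ e f (modelChart d s₀ e f (planeSquare z)) = z := by
    intro z hz
    have h1 : Real.exp (Real.log (planeArea z e ^ 2) / 2) = planeArea z e := by
      rw [Real.log_pow, Nat.cast_two, mul_div_cancel_left₀ _ two_ne_zero, Real.exp_log hz]
    rw [modelChart, areaSq_planeSquare, areaProd_planeSquare, modelParam, h1]
    have h2 := planeArea_smul_eq f e z
    rw [hef, one_smul] at h2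
    conv_rhs => rw [h2]
    rw [smul_add, smul_smul, add_comm]
    congr 2
    have := hz.ne'
    simp only
    field_simp
    ring
  obtain ⟨z, rfl⟩ := exists_planeSquare_eq u
  rw [areaSq_planeSquare] at hu
  -- Of the two square roots z and -z, the one with ω(z, e) > 0 lies in the half-plane that is
  -- parametrized by the group.
  rcases lt_or_gt_of_ne (show planeArea z e ≠ 0 from fun h ↦ by simp [h] at hu) with h | h
  · rw [← planeSquare_neg z, key (-z) ?_]
    have : planeArea (-z) e = -planeArea z e := by simp [planeArea]; ring
    rw [this]
    linarith
  · rw [key z h]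

/-- The inverse of an affine map is affine: cancel the squared parametrization from the identity map
of the group. Surjectivity of its differential comes from its being a left inverse of `modelChart`
near u. -/
theorem isAffineAt_modelChart (hd : d ≠ 0) (s₀ : ℝ) (hef : planeArea f e = 1)
    {u : Plane} (hu : 0 < areaSq e u) :
    IsAffineAt (coneChristoffel d) modelChristoffel (modelChart d s₀ e f) u := by
  set G := modelChart d s₀ e f with hG
  set H := modelParam (2 / d) s₀ e f with hH
  have hHu : (planeSquare ∘ H) (G u) = u := planeSquare_modelParam_modelChart hd s₀ hef hu
  have hH2 : ContDiff ℝ 2 H := (contDiff_modelParam _ s₀ e f).of_le ENat.LEInfty.out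
  have hsq : ContDiff ℝ 2 planeSquare := contDiff_planeSquare.of_le ENat.LEInfty.out
  have hF : ContDiff ℝ 2 (planeSquare ∘ H) := hsq.comp hH2
  have hG2 : ContDiffAt ℝ 2 G u := (contDiffAt_modelChart d s₀ e f hu).of_le ENat.LEInfty.out
  have hH0 : H (G u) ≠ 0 := by
    intro h0
    have := planeArea_modelParam (2 / d) s₀ hef (G u)
    rw [← hH, h0] at this
    exact (Real.exp_pos _).ne (by simpa [planeArea] using this)
  have hleft : G ∘ (planeSquare ∘ H) = id := funext fun p ↦ modelChart_modelParam hd s₀ hef p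
  have hright : (planeSquare ∘ H) ∘ G =ᶠ[𝓝 u] id := by
    filter_upwards [(isOpen_lt continuous_const (continuous_areaSq e)).mem_nhds hu] with w hw
    exact planeSquare_modelParam_modelChart hd s₀ hef hw
  have hsurj : Function.Surjective (fderiv ℝ (planeSquare ∘ H) (G u)) := by
    intro w
    have h1 := hright.fderiv_eq (𝕜 := ℝ)
    rw [fderiv_comp u (hF.contDiffAt.differentiableAt (by simp)) (hG2.differentiableAt (by simp)),
      fderiv_id] at h1
    exact ⟨fderiv ℝ G u w, congrArg (fun T : Plane →L[ℝ] Plane ↦ T w) h1⟩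
  have hA : IsAffineAt modelChristoffel (coneChristoffel d) (planeSquare ∘ H) (G u) :=
    IsAffineAt.comp hsq.contDiffAt hH2.contDiffAt (isAffineAt_planeSquare d hH0)
      (isAffineAt_modelParam hd s₀ hef (G u))
  have := IsAffineAt.of_comp (G := G) (Γ'' := modelChristoffel) (by rwa [hHu]) hF.contDiffAt hA
    hsurj (by rw [hleft]; exact isAffineAt_id _)
  rwa [hHu] at this

variable {M : Type*} [TopologicalSpace M] [ChartedSpace Plane M] [IsManifold (𝓡 2) ∞ M]
  {φ : OpenPartialHomeomorph M Plane}

/-- The affine diffeomorphism from an open subset of the surface to the group. -/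
def modelPartialDiffeomorph (h : IsGlobalChart φ) (hφ : φ.target = {0}ᶜ) (hd : d ≠ 0) (s₀ : ℝ)
    (hef : planeArea f e = 1) : PartialDiffeomorph (𝓡 2) 𝓘(ℝ, ℝ × ℝ) M (ℝ × ℝ) ∞ :=
  have hne : ∀ p, planeSquare (modelParam (2 / d) s₀ e f p) ∈ φ.target := fun p ↦ by
    rw [hφ]
    refine ne_zero_of_areaSq_pos (e := e) ?_
    rw [areaSq_modelParam _ s₀ hef]
    positivity
  have hcont : Continuous φ := continuous_iff_continuousAt.2 h.continuousAt
  { toFun := fun A ↦ modelChart d s₀ e f (φ A)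
    invFun := fun p ↦ φ.symm (planeSquare (modelParam (2 / d) s₀ e f p))
    source := {A | 0 < areaSq e (φ A)}
    target := Set.univ
    map_source' := fun _ _ ↦ Set.mem_univ _
    map_target' := fun p _ ↦ by
      change 0 < areaSq e (φ (φ.symm _))
      rw [φ.right_inv (hne p), areaSq_modelParam _ s₀ hef]
      positivity
    left_inv' := fun A hA ↦ by
      rw [planeSquare_modelParam_modelChart hd s₀ hef hA, h.symm_apply]
    right_inv' := fun p _ ↦ by
      rw [φ.right_inv (hne p), modelChart_modelParam hd s₀ hef]
    open_source := isOpen_lt continuous_const ((continuous_areaSq e).comp hcont)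
    open_target := isOpen_univ
    contMDiffOn_toFun := fun A hA ↦ by
      refine (h.contMDiffAt_vector_iff.2 ?_).contMDiffWithinAt
      refine (contDiffAt_modelChart d s₀ e f hA).congr_of_eventuallyEq ?_
      filter_upwards [h.eventually_apply_symm A] with u hu
      exact congrArg _ hu
    contMDiffOn_invFun := fun p _ ↦ by
      have hs : ContDiff ℝ ∞ (planeSquare ∘ modelParam (2 / d) s₀ e f) :=
        contDiff_planeSquare.comp (contDiff_modelParam _ s₀ e f)
      refine ((isGlobalChart_refl.contMDiffAt_iff h).2 ⟨?_, ?_⟩).contMDiffWithinAt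
      · exact ContinuousAt.comp (g := φ.symm) (f := planeSquare ∘ modelParam (2 / d) s₀ e f) (x := p)
          (φ.continuousAt_symm (hne p)) hs.continuous.continuousAt
      · exact hs.contDiffAt.congr_of_eventuallyEq (.of_forall fun q ↦ φ.right_inv (hne q)) }

theorem representsModuliPoint_coneConnection (h : IsGlobalChart φ) (hφ : φ.target = {0}ᶜ)
    (hd : d ≠ 0) :
    RepresentsModuliPoint (christoffelConnection h (coneChristoffel d)) 1 0 := by
  refine ⟨by simp, fun A q ↦ ?_⟩
  obtain ⟨y, hy⟩ := exists_planeSquare_eq (φ A)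
  have hy0 : y ≠ 0 := by
    rintro rfl
    refine h.apply_ne_zero hφ A (hy.symm.trans ?_)
    ext i
    fin_cases i <;> simp
  have hn := sq_add_sq_pos_of_ne_zero hy0
  -- With s₀ = q.1 the parametrization sends q to exp(q.2) · f, so this f makes q go to y. The
  -- vector e is a multiple of y turned by a right angle, scaled so that ω(f, e) = 1.
  set f : Plane := Real.exp (-q.2) • y with hf
  set e : Plane := (Real.exp q.2 / (y 0 ^ 2 + y 1 ^ 2)) • !₂[-(y 1), y 0] with he
  have hexp : Real.exp q.2 * Real.exp (-q.2) = 1 := by rw [← Real.exp_add]; simp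
  have hef : planeArea f e = 1 := by
    have : planeArea f e = Real.exp q.2 * Real.exp (-q.2) *
        ((y 0 ^ 2 + y 1 ^ 2) / (y 0 ^ 2 + y 1 ^ 2)) := by
      simp [planeArea, hf, he]
      ring
    rw [this, hexp, div_self hn.ne', one_mul]
  have hq : modelParam (2 / d) q.1 e f q = y := by
    rw [modelParam, sub_self, mul_zero, zero_smul, zero_add, hf, smul_smul, hexp, one_smul]
  have hAq : modelChart d q.1 e f (φ A) = q := by
    rw [← hy]
    conv_lhs => rw [← hq]
    exact modelChart_modelParam hd q.1 hef q
  have hpos : 0 < areaSq e (φ A) := by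
    rw [← hy, ← hq, areaSq_modelParam _ q.1 hef]
    positivity
  refine ⟨fun B ↦ modelChart d q.1 e f (φ B), hAq,
    isAffineDiffeoAt_of_isAffineAt h isGlobalChart_refl (hasChristoffel_christoffelConnection h _)
      hasChristoffel_modelConnection (modelPartialDiffeomorph h hφ hd q.1 hef) hpos
      (fun _ _ ↦ rfl) fun B hB ↦ ?_⟩
  refine (isAffineAt_modelChart hd q.1 hef hB).congr ?_
  filter_upwards [h.eventually_apply_symm B] with u hu
  exact congrArg _ hu.symm

end ModelEquivalence

/-! ## The invariant connections on the future null cone -/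

section ConeAction

variable {P : Type*} [NormedAddCommGroup P] [NormedSpace ℝ P]
  {Ω : LinearMap.BilinForm ℝ P} {L : TracelessEnd P ≃L[ℝ] Plane × ℝ}

theorem contDiffAt_coneChart_map {W : Type*} [NormedAddCommGroup W] [NormedSpace ℝ W]
    (L : W ≃L[ℝ] Plane × ℝ) (T : W →L[ℝ] W) {u : Plane} (hu : u ≠ 0) :
    ContDiffAt ℝ ∞ (fun u ↦ (L (T (L.symm (u, ‖u‖)))).1) u := by
  have h1 : ContDiffAt ℝ ∞ (fun u : Plane ↦ (u, ‖u‖)) u := contDiffAt_id.prodMk (contDiffAt_norm ℝ hu)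
  have h2 : ContDiff ℝ ∞ fun w : Plane × ℝ ↦ (L (T (L.symm w))).1 :=
    contDiff_fst.comp (L.contDiff.comp (T.contDiff.comp L.symm.contDiff))
  exact h2.contDiffAt.comp u h1

theorem coneChart_map_eq (hL : IsLorentzCoord Ω L) {T : TracelessEnd P →L[ℝ] TracelessEnd P}
    {f : futureNullCone Ω → futureNullCone Ω} (hf : ∀ A, (f A).1 = T A.1) {u : Plane}
    (hu : u ≠ 0) :
    coneChart hL (f ((coneChart hL).symm u)) = (L (T (L.symm (u, ‖u‖)))).1 := by
  rw [coneChart_apply, hf, coneChart_symm_coe hL hu]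

theorem continuous_of_coe_eq {T : TracelessEnd P →L[ℝ] TracelessEnd P}
    {f : futureNullCone Ω → futureNullCone Ω} (hf : ∀ A, (f A).1 = T A.1) : Continuous f := by
  rw [Topology.IsInducing.subtypeVal.continuous_iff]
  have : Subtype.val ∘ f = fun A ↦ T A.1 := funext hf
  rw [this]
  exact T.continuous.comp continuous_subtype_val

theorem contDiffAt_coneChart_comp (hL : IsLorentzCoord Ω L)
    {T : TracelessEnd P →L[ℝ] TracelessEnd P}
    {f : futureNullCone Ω → futureNullCone Ω} (hf : ∀ A, (f A).1 = T A.1) {u : Plane}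
    (hu : u ≠ 0) : ContDiffAt ℝ ∞ (coneChart hL ∘ f ∘ (coneChart hL).symm) u := by
  refine (contDiffAt_coneChart_map (W := TracelessEnd P) L T hu).congr_of_eventuallyEq ?_
  filter_upwards [isOpen_compl_singleton.mem_nhds hu] with w hw
  exact coneChart_map_eq hL hf hw

/-- The inverse diffeomorphism is the restriction of T⁻¹, which preserves the cone since the
identity component is a group; affineness comes from the lift of T to spinors. -/
theorem isAffineDiffeoAt_futureNullCone (hL : IsLorentzCoord Ω L)
    [ChartedSpace Plane (futureNullCone Ω)] [IsManifold (𝓡 2) ∞ (futureNullCone Ω)]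
    (h : IsGlobalChart (coneChart hL)) (d : ℝ)
    {T : (TracelessEnd P →L[ℝ] TracelessEnd P)ˣ} (hT : T ∈ lorentzIdentityComponent P)
    {f : futureNullCone Ω → futureNullCone Ω} (hf : ∀ A, (f A).1 = T.1 A.1)
    (A : futureNullCone Ω) :
    IsAffineDiffeoAt (christoffelConnection h (coneChristoffel d))
      (christoffelConnection h (coneChristoffel d)) f A := by
  have hinv := hL.mapsTo (inv_mem hT)
  let f' : futureNullCone Ω → futureNullCone Ω := fun A ↦ ⟨T⁻¹.1 A.1, hinv A.2⟩
  have hf' : ∀ A, (f' A).1 = T⁻¹.1 A.1 := fun _ ↦ rfl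
  obtain ⟨g, hg, hg'⟩ := hL.exists_nullVector_lift hT
  refine isAffineDiffeoAt_of_lift h (coneChart_target hL) d (continuous_of_coe_eq hf)
    (continuous_of_coe_eq hf') (fun A ↦ contDiffAt_coneChart_comp hL hf (hL.fst_ne_zero A))
    (fun A ↦ contDiffAt_coneChart_comp hL hf' (hL.fst_ne_zero A)) (fun A ↦ ?_) (fun A ↦ ?_) hg
    (fun z hz ↦ ?_) A
  · refine Subtype.ext ((hf' _).trans ?_)
    rw [hf]
    exact congrArg (fun U : TracelessEnd P →L[ℝ] TracelessEnd P ↦ U A.1) T.inv_mul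
  · refine Subtype.ext ((hf _).trans ?_)
    rw [hf']
    exact congrArg (fun U : TracelessEnd P →L[ℝ] TracelessEnd P ↦ U A.1) T.mul_inv
  · rw [coneChart_map_eq hL hf (planeSquare_ne_zero hz)]
    have : (planeSquare z, ‖planeSquare z‖) = nullVector z := Prod.ext rfl (norm_planeSquare z)
    rw [this, hg']
    rfl

end ConeAction

theorem proposition18p1 {P : Type*} [NormedAddCommGroup P] [NormedSpace ℝ P]
    (hP : Module.finrank ℝ P = 2)
    (Ω : LinearMap.BilinForm ℝ P) (hΩ : Ω.IsAlt) (hΩ0 : Ω ≠ 0) :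
    -- `SO↑(V)` acts on the future null cone, and the action is transitive
    (∀ T ∈ lorentzIdentityComponent P,
      Set.MapsTo T.1 (futureNullCone Ω) (futureNullCone Ω)) ∧
    (∀ A ∈ futureNullCone Ω, ∀ B ∈ futureNullCone Ω,
      ∃ T ∈ lorentzIdentityComponent P, T.1 A = B) ∧
    -- the future null cone is an embedded surface in `V`
    ∃ (_ : ChartedSpace (EuclideanSpace ℝ (Fin 2)) (futureNullCone Ω))
      (_ : IsManifold (𝓡 2) ∞ (futureNullCone Ω)),
      Manifold.IsSmoothEmbedding (𝓡 2) 𝓘(ℝ, TracelessEnd P) ∞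
        (Subtype.val : futureNullCone Ω → TracelessEnd P) ∧
      -- the family of connections, with parameter `c ≠ 0`
      ∃ conn : ℝ → CovariantDerivative (𝓡 2) (EuclideanSpace ℝ (Fin 2))
          (TangentSpace (𝓡 2) : futureNullCone Ω → Type _),
        (∀ c : ℝ, c ≠ 0 →
          IsNonzeroRSTS (conn c) ∧
          (∀ T ∈ lorentzIdentityComponent P, ∀ f : futureNullCone Ω → futureNullCone Ω,
            (∀ A, (f A).1 = T.1 A.1) → ∀ A, IsAffineDiffeoAt (conn c) (conn c) f A) ∧
          RepresentsModuliPoint (conn c) 1 0) ∧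
        -- distinct parameters give distinct connections
        (∀ c c' : ℝ, c ≠ 0 → c' ≠ 0 → c ≠ c' →
          ∃ (X : Π A : futureNullCone Ω, TangentSpace (𝓡 2) A) (A : futureNullCone Ω),
            SmoothFieldAt X A ∧ conn c X A ≠ conn c' X A) ∧
        -- the connections depend smoothly on the parameter
        (∀ X Y : Π A : futureNullCone Ω, TangentSpace (𝓡 2) A,
          (∀ A, SmoothFieldAt X A) → (∀ A, SmoothFieldAt Y A) →
          ContMDiffOn (𝓘(ℝ, ℝ).prod (𝓡 2)) (𝓡 2).tangent ∞
            (fun q : ℝ × futureNullCone Ω ↦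
              (⟨q.2, conn q.1 Y q.2 (X q.2)⟩ : TangentBundle (𝓡 2) (futureNullCone Ω)))
            ({0}ᶜ ×ˢ Set.univ)) := by
  obtain ⟨L, hL⟩ := exists_isLorentzCoord hP Ω hΩ hΩ0
  refine ⟨fun T hT ↦ hL.mapsTo hT, fun A hA B hB ↦ hL.exists_map_eq hA hB, ?_⟩
  have hsource : (coneChart hL).source = Set.univ := rfl
  -- The surface structure is given by the atlas with one chart, so there are no transition maps to
  -- check.
  let cs := (coneChart hL).singletonChartedSpace hsource
  have hm : IsManifold (𝓡 2) ∞ (futureNullCone Ω) :=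
    (coneChart hL).isManifold_singleton (I := 𝓡 2) hsource
  have h : IsGlobalChart (coneChart hL) :=
    ⟨hsource, fun _ ↦ (coneChart hL).singletonChartedSpace_chartAt_eq hsource⟩
  have ht := coneChart_target hL
  exact ⟨cs, hm, isSmoothEmbedding_futureNullCone hL h,
    -- The formula also makes sense at c = 0, where the lift is the flat connection; only c ≠ 0 is
    -- used.
    fun c ↦ christoffelConnection h (coneChristoffel c),
    fun c hc ↦ ⟨isNonzeroRSTS_coneConnection h ht hc,
      fun T hT f hf A ↦ isAffineDiffeoAt_futureNullCone hL h c hT hf A,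
      representsModuliPoint_coneConnection h ht hc⟩,
    fun c c' _ _ hcc ↦ coneConnection_ne h ht hcc,
    fun X Y hX hY ↦ contMDiffOn_coneConnection h ht hX hY _⟩
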